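/- Let $p\in(0,1)$, $\gamma\in[0,1/p)$, $\varrho\in(0,1)$ and $\sigma=1-\varrho$. Consider the backward generalized TASEP on the periodic lattice $\mathbb Z/L\mathbb Z$ with exclusion: in every time step, independently for each maximal block of $n\ge 1$ consecutive particles followed by an empty site, exactly the $k$ foremost particles of the block ($0\le k\le n$) move one site forward, with probability $$p(0|n)=1-p,\qquad p(k|n)=p(p\gamma)^{k-1}(1-p\gamma)\ (0<k<n),\qquad p(n|n)=p(p\gamma)^{n-1}.$$ The number $N$ of particles is conserved, and for all $L\ge1$, $0\le N\le L$ there is exactly one stationary probability measure $\mathcal P_{L,N}$ on the configurations $\boldsymbol\tau\in\{0,1\}^{\mathbb Z/L\mathbb Z}$ with $N$ particles. For every pattern $(s_1,\dots,s_n)\in\{0,1\}^n$ the limit $$\mathcal P_\varrho(s_1\dots s_n)=\lim_{L\to\infty}\mathcal P_{L,\lfloor\varrho L\rfloor}(\tau_{x+j}=s_j,\ j=1,\dots,n)$$ exists and does not depend on the choice of the site $x$ (which may vary with $L$); moreover $\mathcal P_\varrho(1)=\varrho$ and $\mathcal P_\varrho(0)=\sigma$. Put $$A=\frac{p(1-\gamma)}{1-p\gamma},\qquad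 z=\frac{1-\sqrt{1-4\varrho\sigma A}}{2A}\quad(z=\varrho\sigma\text{ if }\gamma=1),$$ so that $Az^2-z+\varrho\sigma=0$. Then: 1. (Cluster-size law.) $\mathcal P_\varrho(0\,1^n\,0)/\mathcal P_\varrho(0)=\phi(n)$ for all $n\ge0$, where $\phi(0)=1-\frac z\sigma$ and $\phi(n)=\frac{z^2}{\varrho\sigma}\left(1-\frac z\varrho\right)^{n-1}$ for $n\ge1$. 2. (Distance-headway law.) $\wp(d):=\mathcal P_\varrho(1\,0^d\,1)/\mathcal P_\varrho(1)$ is given by the same formulas with $\varrho$ and $\sigma$ interchanged: $\wp(0)=1-\frac z\varrho$ and $\wp(d)=\frac{z^2}{\varrho\sigma}\left(1-\frac z\sigma\right)^{d-1}$ for $d\ge1$. 3. (Flow.) The stationary flow (the mean number of particles that hop from $x$ to $x+1$ in one time step under $\mathcal P_{L,\lfloor\varrho L\rfloor}$) converges, as $L\to\infty$, to $$J_\leftarrow=\sum_{n=1}^{\infty}\mathcal P_\varrho(1^n\,0)\,p(p\gamma)^{n-1}=\frac{pz}{1-p\gamma\left(1-z/\varrho\right)}.$$ -/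

import Mathlib

open Filter Topology

namespace GenTASEP

/-- Configurations on the periodic lattice with `L` sites; `true` is an occupied site,
`false` an empty one. -/
abbrev Config (L : ℕ) : Type := ZMod L → Bool

/-- The empty sites of a configuration. -/
abbrev Hole {L : ℕ} (τ : Config L) : Type := {h : ZMod L // τ h = false}

/-- The number of particles. -/
def particleCount {L : ℕ} [NeZero L] (τ : Config L) : ℕ :=
  (Finset.univ.filter fun x : ZMod L => τ x = true).card

/-- The length of the (possibly empty) block of particles that occupies the sites
`h - 1, h - 2, …` immediately behind the empty site `h`. -/
def blockLength {L : ℕ} (τ : Config L) (h : Hole τ) : ℕ :=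
  Nat.findGreatest (fun n : ℕ => ∀ j : Fin n, τ (h.1 - ((j : ℕ) + 1 : ℕ)) = true) L

/-- The probability `p(k|n)` that exactly the `k` foremost particles of a block of `n` particles
move by one site; an empty block moves nothing. -/
noncomputable def hopProb (p γ : ℝ) (k n : ℕ) : ℝ :=
  if n = 0 then (if k = 0 then 1 else 0)
  else if k = 0 then 1 - p
  else if k < n then p * (p * γ) ^ (k - 1) * (1 - p * γ)
  else if k = n then p * (p * γ) ^ (n - 1)
  else 0

/-- An outcome of one update: for each empty site, how many particles of the block behind it
move forward. -/
abbrev Outcome {L : ℕ} (τ : Config L) : Type :=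
  (h : Hole τ) → Fin (blockLength τ h + 1)

/-- In one backward update step, the blocks move independently of each other. -/
noncomputable def outcomeProb {L : ℕ} [NeZero L] (p γ : ℝ) (τ : Config L) (k : Outcome τ) : ℝ :=
  ∏ h : Hole τ, hopProb p γ (k h) (blockLength τ h)

/-- The particle at site `x` hops to `x + 1`: the site `x` is among the first `k h` sites of the
block behind some empty site `h`. -/
def Hops {L : ℕ} (τ : Config L) (k : Outcome τ) (x : ZMod L) : Prop :=
  ∃ h : Hole τ, ∃ j ∈ Finset.Icc 1 (k h : ℕ), x = h.1 - (j : ZMod L)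

instance {L : ℕ} [NeZero L] (τ : Config L) (k : Outcome τ) (x : ZMod L) :
    Decidable (Hops τ k x) := by
  unfold Hops; infer_instance

/-- The configuration after the update: a site is occupied if its particle stayed or if a particle
arrived from the preceding site. -/
def update {L : ℕ} [NeZero L] (τ : Config L) (k : Outcome τ) : Config L :=
  fun x => decide ((τ x = true ∧ ¬ Hops τ k x) ∨ Hops τ k (x - 1))

/-- The one-step transition probability `W(τ → τ')` of the backward generalized TASEP. -/
noncomputable def W {L : ℕ} [NeZero L] (p γ : ℝ) (τ τ' : Config L) : ℝ :=
  ∑ k : Outcome τ, if update τ k = τ' then outcomeProb p γ τ k else 0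

/-- `P` is a stationary probability measure with `N` particles (given by the probabilities of the
single configurations). -/
structure IsStationaryMeasure {L : ℕ} [NeZero L] (p γ : ℝ) (N : ℕ) (P : Config L → ℝ) :
    Prop where
  nonneg : ∀ τ, 0 ≤ P τ
  support : ∀ τ, particleCount τ ≠ N → P τ = 0
  total : ∑ τ, P τ = 1
  balance : ∀ τ, particleCount τ = N →
    ∑ τ' ∈ Finset.univ.filter (fun τ' => τ' ≠ τ), W p γ τ τ' * P τ =
      ∑ τ' ∈ Finset.univ.filter (fun τ' => τ' ≠ τ), W p γ τ' τ * P τ'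

/-- The cluster probability `P(τ_{x+1} = s_1, …, τ_{x+n} = s_n)`. -/
noncomputable def clusterProb {L : ℕ} [NeZero L] (P : Config L → ℝ) (x : ZMod L)
    (s : List Bool) : ℝ :=
  ∑ τ : Config L,
    if ∀ j : Fin s.length, τ (x + ((j : ℕ) + 1 : ℕ)) = s.get j then P τ else 0

/-- The flow through the bond `(x, x + 1)`: the probability under `P` that a particle hops from
`x` to `x + 1` in one step, i.e. the mean number of particles crossing the bond per step. -/
noncomputable def flow {L : ℕ} [NeZero L] (p γ : ℝ) (P : Config L → ℝ) (x : ZMod L) : ℝ :=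
  ∑ τ : Config L, P τ * ∑ k : Outcome τ, if Hops τ k x then outcomeProb p γ τ k else 0

/-- `A(p, γ) = p (1 - γ) / (1 - p γ)`. -/
noncomputable def A (p γ : ℝ) : ℝ := p * (1 - γ) / (1 - p * γ)

/-- `z = (1 - √(1 - 4 ρ σ A)) / (2 A)` with `σ = 1 - ρ`, to be read as its limit `ρ σ`
for `γ = 1`, where `A = 0`. -/
noncomputable def z (p γ ρ : ℝ) : ℝ :=
  if γ = 1 then ρ * (1 - ρ)
  else (1 - Real.sqrt (1 - 4 * ρ * (1 - ρ) * A p γ)) / (2 * A p γ)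

/-- The function `φ(n; ρ)`. -/
noncomputable def clusterLaw (p γ ρ : ℝ) (n : ℕ) : ℝ :=
  if n = 0 then 1 - z p γ ρ / (1 - ρ)
  else z p γ ρ ^ 2 / (ρ * (1 - ρ)) * (1 - z p γ ρ / ρ) ^ (n - 1)

/-- The value `p z / (1 - p γ (1 - z / ρ))`. -/
noncomputable def flowValue (p γ ρ : ℝ) : ℝ :=
  p * z p γ ρ / (1 - p * γ * (1 - z p γ ρ / ρ))

end GenTASEP

/-!
Let `B` be the number of nonempty blocks of a configuration and `c = (1 - pγ) / (1 - p)`.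

*Stationarity.* Record an update by the set of hopping particles. The product of `c ^ B` and the
probability of the update is a product of local factors: each run of hopping particles contributes
`pc · pγ ⋯ pγ` and each run of staying ones `1 - pγ`. Read in a mirror, the new configuration and
the particles that have just arrived form an update with the same runs, which leads to the mirror
image of the old configuration. So the time-reversed process is the mirror image of the process
(`pow_blocks_mul_W`), and `c ^ B` is stationary. Since adjacent exchanges have positive
probability, the Dirichlet form of the density of another stationary measure forces it to be
constant on each particle-number sector (`IsStationaryMeasure.eq_gibbs`). Everything else is about
this Gibbs measure on the ring of `L` sites with `N` particles.

*Segment reversal.* Reversing the segment `o + 1, …, o + y` alters only its two end bonds. If `o`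
and `o + y + 1` are in the same state `a`, the weight is unchanged and the bond at `o` trades
places with the bond at `o + y`. Summed over `y`, this says that after any pattern that ends in
`a`, the next site is in the state `a` with the empirical frequency of bonds `aa` among the bonds
that start in `a`, which is `1 - B / N` or `1 - B / (L - N)` (`abs_siteCount_mul_sub_le`). If the
two end bonds are `11` and `00`, they become `10` and `10` and `B` grows by one; summed over both
positions, `E[ψ(B + 1) c (N - B) (L - N - B)] = E[ψ(B) (B² - B)]` for every `ψ`
(`gibbs_blocks_recursion`). With `ψ(B) = B - z L`, where `c (ρ - z) (1 - ρ - z) = z²`, this bounds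
the variance of `B` about `z L` by a multiple of `L` (`blocks_second_moment_le`).

*Limit.* Hence the cluster probabilities converge to those of the two-state Markov chain with
densities `ρ`, `1 - ρ` that leaves the occupied state with probability `z / ρ` and the empty one
with probability `z / (1 - ρ)` (`tendsto_clusterProb`), and the gap laws are geometric. A particle
with `n` others between it and the next hole hops with probability `p (pγ) ^ n`, so the flow is a
sum of cluster probabilities that converges by domination (`tendsto_flow`).
-/

namespace GenTASEP

/-! ### The blocks of a configuration -/

theorem occupied_of_le_blockLength {L : ℕ} (τ : Config L) (h : Hole τ) {i : ℕ}
    (h1 : 1 ≤ i) (hi : i ≤ blockLength τ h) : τ (h.1 - (i : ZMod L)) = true := by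
  have := Nat.findGreatest_spec (P := fun n : ℕ => ∀ j : Fin n, τ (h.1 - ((j : ℕ) + 1 : ℕ)) = true)
    (Nat.zero_le L) (fun j => j.elim0) ⟨i - 1, by unfold blockLength at hi; omega⟩
  simpa [Nat.sub_add_cancel h1] using this

theorem le_blockLength {L : ℕ} [NeZero L] (τ : Config L) (h : Hole τ) {n : ℕ}
    (hn : ∀ i : ℕ, 1 ≤ i → i ≤ n → τ (h.1 - (i : ZMod L)) = true) : n ≤ blockLength τ h := by
  have hnL : n ≤ L := by
    by_contra hlt
    have := hn L (NeZero.one_le) (by omega)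
    simp [h.2] at this
  exact Nat.le_findGreatest hnL fun j => hn _ (by omega) (by omega)

theorem blockLength_lt {L : ℕ} [NeZero L] (τ : Config L) (h : Hole τ) : blockLength τ h < L := by
  by_contra hlt
  have := occupied_of_le_blockLength τ h (i := L) NeZero.one_le (by omega)
  simp [h.2] at this

/-- A site belongs to one block only (a block being counted together with the hole in front of
it), and only once. -/
theorem block_unique {L : ℕ} [NeZero L] (τ : Config L) (h h' : Hole τ) {i i' : ℕ}
    (hi : i ≤ blockLength τ h) (hi' : i' ≤ blockLength τ h')
    (he : h.1 - (i : ZMod L) = h'.1 - (i' : ZMod L)) : h = h' ∧ i = i' := by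
  wlog hle : i ≤ i' generalizing h h' i i'
  · have := this h' h hi' hi he.symm (by omega)
    exact ⟨this.1.symm, this.2.symm⟩
  rcases hle.eq_or_lt with rfl | hlt
  · exact ⟨Subtype.ext (by simpa using he), rfl⟩
  · exfalso
    have h1 := occupied_of_le_blockLength τ h' (i := i' - i) (by omega) (by omega)
    have h2 : h'.1 - ((i' - i : ℕ) : ZMod L) = h.1 := by
      rw [Nat.cast_sub hle]; linear_combination -he
    rw [h2, h.2] at h1
    cases h1

theorem exists_block {L : ℕ} [NeZero L] (τ : Config L) [hne : Nonempty (Hole τ)] (x : ZMod L) :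
    ∃ h : Hole τ, ∃ i ≤ blockLength τ h, h.1 - (i : ZMod L) = x := by
  have hex : ∃ i : ℕ, τ (x + i) = false := by
    obtain ⟨h⟩ := hne
    exact ⟨(h.1 - x).val, by simp [h.2]⟩
  refine ⟨⟨x + (Nat.find hex : ℕ), Nat.find_spec hex⟩, Nat.find hex, ?_, by simp⟩
  refine le_blockLength τ _ fun i h1 hi => ?_
  have := Nat.find_min hex (m := Nat.find hex - i) (by omega)
  rw [Nat.cast_sub hi] at this
  simpa [add_sub_assoc] using this

/-- The ring is the disjoint union of the blocks, each taken together with the hole in front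
of it. -/
theorem prod_blocks {L : ℕ} [NeZero L] (τ : Config L) [Nonempty (Hole τ)] (g : ZMod L → ℝ) :
    ∏ x, g x = ∏ h : Hole τ, ∏ i ∈ Finset.range (blockLength τ h + 1), g (h.1 - (i : ZMod L)) := by
  have hb : Function.Bijective
      (fun q : (Σ h : Hole τ, Fin (blockLength τ h + 1)) => q.1.1 - ((q.2 : ℕ) : ZMod L)) := by
    constructor
    · rintro ⟨h, i⟩ ⟨h', i'⟩ he
      obtain ⟨rfl, hi⟩ := block_unique τ h h' (Nat.le_of_lt_succ i.2) (Nat.le_of_lt_succ i'.2) he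
      have hi : i = i' := Fin.ext hi
      rw [hi]
    · intro x
      obtain ⟨h, i, hi, rfl⟩ := exists_block τ x
      exact ⟨⟨h, ⟨i, by omega⟩⟩, rfl⟩
  rw [← (Equiv.ofBijective _ hb).prod_comp, Fintype.prod_sigma]
  refine Finset.prod_congr rfl fun h _ => ?_
  rw [Finset.prod_range]
  rfl

/-! ### Updates as sets of hopping particles -/

/-- `u` marks the particles that hop in some update of `τ`: a marked particle is followed by an
empty site or by another marked particle. On the full ring, where nothing moves, the last clause
excludes the rotation of all the particles at once. -/
def Valid {L : ℕ} (τ u : Config L) : Prop :=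
  (∀ x, u x = true → τ x = true ∧ (τ (x + 1) = true → u (x + 1) = true)) ∧ ∃ x, u x = false

instance {L : ℕ} [NeZero L] (τ u : Config L) : Decidable (Valid τ u) := by
  unfold Valid; infer_instance

/-- The configuration that arises from `τ` when the particles marked by `u` hop. -/
def move {L : ℕ} (τ u : Config L) : Config L := fun x => (τ x && !u x) || u (x - 1)

/-- The contribution of the site `x` to the probability that exactly the particles marked by `u`
hop. -/
noncomputable def siteProb {L : ℕ} (p γ : ℝ) (τ u : Config L) (x : ZMod L) : ℝ :=
  if τ x = true then
    if τ (x + 1) = true then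
      if u x = true then p * γ else if u (x + 1) = true then 1 - p * γ else 1
    else if u x = true then p else 1 - p
  else 1

/-- The marking that belongs to an outcome. -/
def marks {L : ℕ} [NeZero L] (τ : Config L) (k : Outcome τ) : Config L :=
  fun x => decide (Hops τ k x)

theorem hops_iff {L : ℕ} [NeZero L] (τ : Config L) (k : Outcome τ) (h : Hole τ) {i : ℕ}
    (hi : i ≤ blockLength τ h) : Hops τ k (h.1 - (i : ZMod L)) ↔ 1 ≤ i ∧ i ≤ k h := by
  constructor
  · rintro ⟨h', j, hj, he⟩
    rw [Finset.mem_Icc] at hj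
    obtain ⟨rfl, rfl⟩ := block_unique τ h h' hi (by have := (k h').2; omega) he
    exact hj
  · intro hik
    exact ⟨h, i, Finset.mem_Icc.2 hik, rfl⟩

theorem marks_eq {L : ℕ} [NeZero L] (τ : Config L) (k : Outcome τ) (h : Hole τ) {i : ℕ}
    (hi : i ≤ blockLength τ h) :
    marks τ k (h.1 - (i : ZMod L)) = decide (1 ≤ i ∧ i ≤ (k h : ℕ)) := by
  simp only [marks, hops_iff τ k h hi]

theorem update_eq_move {L : ℕ} [NeZero L] (τ : Config L) (k : Outcome τ) :
    update τ k = move τ (marks τ k) := by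
  funext x
  simp [update, move, marks]

theorem marks_of_isEmpty {L : ℕ} [NeZero L] (τ : Config L) [IsEmpty (Hole τ)] (k : Outcome τ) :
    marks τ k = fun _ => false := by
  funext x
  simp only [marks, decide_eq_false_iff_not]
  rintro ⟨h, -⟩
  exact isEmptyElim h

theorem eq_true_of_isEmpty {L : ℕ} (τ : Config L) [IsEmpty (Hole τ)] (x : ZMod L) :
    τ x = true := by
  by_contra hx
  exact isEmptyElim (⟨x, by simpa using hx⟩ : Hole τ)

theorem valid_marks {L : ℕ} [NeZero L] (τ : Config L) (k : Outcome τ) : Valid τ (marks τ k) := by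
  rcases isEmpty_or_nonempty (Hole τ) with he | hne
  · rw [marks_of_isEmpty]
    exact ⟨by simp, 0, rfl⟩
  · refine ⟨fun x hx => ?_, ?_⟩
    · obtain ⟨h, i, hi, rfl⟩ := exists_block τ x
      rw [marks_eq τ k h hi, decide_eq_true_eq] at hx
      refine ⟨occupied_of_le_blockLength τ h hx.1 hi, ?_⟩
      have hs : h.1 - (i : ZMod L) + 1 = h.1 - ((i - 1 : ℕ) : ZMod L) := by
        rw [Nat.cast_sub hx.1]; push_cast; ring
      rw [hs, marks_eq τ k h (by omega), decide_eq_true_eq]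
      intro ht
      refine ⟨?_, by omega⟩
      by_contra h0
      have : i - 1 = 0 := by omega
      rw [this] at ht
      simp [h.2] at ht
    · obtain ⟨h⟩ := hne
      have := marks_eq τ k h (Nat.zero_le _)
      exact ⟨h.1, by simpa using this⟩

theorem marks_injective {L : ℕ} [NeZero L] (τ : Config L) : Function.Injective (marks τ) := by
  intro k k' he
  funext h
  have key : ∀ i ≤ blockLength τ h, (1 ≤ i ∧ i ≤ (k h : ℕ)) ↔ (1 ≤ i ∧ i ≤ (k' h : ℕ)) := by
    intro i hi
    have := congrFun he (h.1 - (i : ZMod L))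
    rwa [marks_eq τ k h hi, marks_eq τ k' h hi, decide_eq_decide] at this
  have h1 := key (k h) (by omega)
  have h2 := key (k' h) (by omega)
  exact Fin.ext (by omega)

theorem exists_marks_eq {L : ℕ} [NeZero L] (τ u : Config L) (hu : Valid τ u) :
    ∃ k : Outcome τ, marks τ k = u := by
  rcases isEmpty_or_nonempty (Hole τ) with he | hne
  · refine ⟨fun h => isEmptyElim h, ?_⟩
    rw [marks_of_isEmpty]
    -- on the full ring the marks spread from any marked particle to all of them
    obtain ⟨x, hx⟩ := hu.2
    have key : ∀ i : ℕ, u (x - i) = false := by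
      intro i
      induction i with
      | zero => simpa using hx
      | succ i ih =>
        by_contra hc
        have := (hu.1 _ (Bool.of_not_eq_false hc)).2 (eq_true_of_isEmpty τ _)
        rw [show x - ((i + 1 : ℕ) : ZMod L) + 1 = x - i by push_cast; ring, ih] at this
        cases this
    funext y
    have := key (x - y).val
    simpa using this.symm
  · have hhole : ∀ h : Hole τ, u h.1 = false := by
      intro h
      by_contra hc
      have := (hu.1 h.1 (by simpa using hc)).1
      simp [h.2] at this
    have hdown : ∀ (h : Hole τ) (i : ℕ), 1 ≤ i → i ≤ blockLength τ h →
        u (h.1 - ((i + 1 : ℕ) : ZMod L)) = true → u (h.1 - (i : ZMod L)) = true := by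
      intro h i h1 hi hui
      have := (hu.1 _ hui).2
      rw [show h.1 - ((i + 1 : ℕ) : ZMod L) + 1 = h.1 - i by push_cast; ring] at this
      exact this (occupied_of_le_blockLength τ h h1 hi)
    let k : Outcome τ := fun h =>
      ⟨Nat.findGreatest (fun i : ℕ => u (h.1 - (i : ZMod L)) = true) (blockLength τ h),
        Nat.lt_succ_of_le (Nat.findGreatest_le _)⟩
    have hk : ∀ (h : Hole τ) (i : ℕ), i ≤ blockLength τ h →
        u (h.1 - (i : ZMod L)) = decide (1 ≤ i ∧ i ≤ (k h : ℕ)) := by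
      intro h i hi
      rw [Bool.eq_iff_iff, decide_eq_true_eq]
      constructor
      · intro hui
        refine ⟨?_, Nat.le_findGreatest hi hui⟩
        by_contra h0
        have : i = 0 := by omega
        subst this
        simp [hhole h] at hui
      · rintro ⟨h1, hik⟩
        have htop : u (h.1 - ((k h : ℕ) : ZMod L)) = true :=
          Nat.findGreatest_of_ne_zero (P := fun i : ℕ => u (h.1 - (i : ZMod L)) = true)
            (n := blockLength τ h) rfl (by omega)
        have hkn : (k h : ℕ) ≤ blockLength τ h := by have := (k h).2; omega
        have : ∀ d : ℕ, d < (k h : ℕ) → u (h.1 - (((k h : ℕ) - d : ℕ) : ZMod L)) = true := by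
          intro d
          induction d with
          | zero => intro _; simpa using htop
          | succ d ih =>
            intro hd
            refine hdown h _ (by omega) (by omega) ?_
            rw [show (k h : ℕ) - (d + 1) + 1 = (k h : ℕ) - d by omega]
            exact ih (by omega)
        have h2 := this ((k h : ℕ) - i) (by omega)
        rwa [show (k h : ℕ) - ((k h : ℕ) - i) = i by omega] at h2
    refine ⟨k, ?_⟩
    funext x
    obtain ⟨h, i, hi, rfl⟩ := exists_block τ x
    rw [marks_eq τ k h hi, hk h i hi]

/-- Read from the hole backwards, a block contributes the factors `p, pγ, …, pγ, 1 - pγ, 1, …`. -/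
theorem hopProb_eq_prod (p γ : ℝ) {k n : ℕ} (hk : k ≤ n) :
    hopProb p γ k n = ∏ i ∈ Finset.range n,
      (if i = 0 then (if i < k then p else 1 - p)
        else if i < k then p * γ else if i = k then 1 - p * γ else 1) := by
  induction n with
  | zero => simp [hopProb]; omega
  | succ n ih =>
    rw [Finset.prod_range_succ]
    rcases hk.eq_or_lt with rfl | hlt
    · -- the whole block moves
      have : ∀ m ≤ n, ∏ i ∈ Finset.range (m + 1), (if i = 0 then (if i < n + 1 then p else 1 - p)
        else if i < n + 1 then p * γ else if i = n + 1 then 1 - p * γ else 1) =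
          p * (p * γ) ^ m := by
        intro m
        induction m with
        | zero => intro _; simp
        | succ m ihm =>
          intro hm
          rw [Finset.prod_range_succ, ihm (by omega)]
          simp [show m + 1 < n + 1 by omega, pow_succ, mul_assoc]
      rw [← Finset.prod_range_succ, this n le_rfl]
      simp [hopProb]
    · rw [← ih (by omega)]
      rcases Nat.eq_zero_or_pos k with rfl | hk0
      · rcases Nat.eq_zero_or_pos n with rfl | hn0
        · simp [hopProb]
        · simp [hopProb, hn0.ne']
      · have hn0 : 0 < n := by omega
        rcases (show k ≤ n by omega).eq_or_lt with rfl | hkn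
        · simp [hopProb, hk0.ne']
        · simp [hopProb, hk0.ne', hn0.ne', hkn, hkn.ne', hlt, show ¬ n < k by omega]

theorem outcomeProb_eq_prod {L : ℕ} [NeZero L] (p γ : ℝ) (τ : Config L) (k : Outcome τ) :
    outcomeProb p γ τ k = ∏ x, siteProb p γ τ (marks τ k) x := by
  rcases isEmpty_or_nonempty (Hole τ) with he | hne
  · rw [marks_of_isEmpty, outcomeProb, Finset.univ_eq_empty, Finset.prod_empty]
    simp [siteProb, eq_true_of_isEmpty τ]
  · rw [prod_blocks τ, outcomeProb]
    refine Finset.prod_congr rfl fun h _ => ?_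
    have hkn : (k h : ℕ) ≤ blockLength τ h := by have := (k h).2; omega
    rw [Finset.prod_range_succ', hopProb_eq_prod p γ hkn]
    have h0 : siteProb p γ τ (marks τ k) (h.1 - ((0 : ℕ) : ZMod L)) = 1 := by
      simp [siteProb, h.2]
    rw [h0, mul_one]
    refine Finset.prod_congr rfl fun i hi => ?_
    rw [Finset.mem_range] at hi
    have e1 : h.1 - ((i + 1 : ℕ) : ZMod L) + 1 = h.1 - (i : ZMod L) := by push_cast; ring
    rw [siteProb, e1, marks_eq τ k h (by omega : i + 1 ≤ _), marks_eq τ k h (by omega : i ≤ _),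
      if_pos (occupied_of_le_blockLength τ h (by omega) (by omega))]
    rcases Nat.eq_zero_or_pos i with rfl | hi0
    · simp [h.2, Nat.one_le_iff_ne_zero, Nat.pos_iff_ne_zero]
    · rw [if_pos (occupied_of_le_blockLength τ h hi0 (by omega)), if_neg hi0.ne']
      by_cases h1 : i < k h
      · simp [h1, Nat.succ_le_of_lt h1]
      · have h2 : ¬ (i + 1 ≤ (k h : ℕ)) := by omega
        have h3 : i ≤ (k h : ℕ) ↔ i = k h := by omega
        simp [h1, h2, h3, Nat.one_le_iff_ne_zero, hi0.ne']

/-- The transition probability as a sum over the sets of hopping particles. -/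
theorem W_eq_sum {L : ℕ} [NeZero L] (p γ : ℝ) (τ τ' : Config L) :
    W p γ τ τ' = ∑ u : Config L,
      if Valid τ u ∧ move τ u = τ' then ∏ x, siteProb p γ τ u x else 0 := by
  have h1 : ∀ u : Config L, (if Valid τ u ∧ move τ u = τ' then ∏ x, siteProb p γ τ u x else 0) =
      if Valid τ u then (if move τ u = τ' then ∏ x, siteProb p γ τ u x else 0) else 0 :=
    fun u => ite_and _ _ _ _
  simp_rw [h1]
  rw [← Finset.sum_filter, W]
  refine Finset.sum_bij (fun k _ => marks τ k) ?_ ?_ ?_ ?_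
  · intro k _
    simpa using valid_marks τ k
  · intro k _ k' _ he
    exact marks_injective τ he
  · intro u hu
    obtain ⟨k, hk⟩ := exists_marks_eq τ u (by simpa using hu)
    exact ⟨k, Finset.mem_univ _, hk⟩
  · intro k _
    rw [update_eq_move, outcomeProb_eq_prod]

/-! ### The transition probabilities -/

/-- The probability that at least `n` particles of a block of `N` move. -/
theorem hopProb_tail (p γ : ℝ) {n N : ℕ} (hn : 1 ≤ n) (hN : n ≤ N) :
    ∑ k : Fin (N + 1), (if n ≤ (k : ℕ) then hopProb p γ k N else 0) = p * (p * γ) ^ (n - 1) := by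
  rw [Finset.sum_fin_eq_sum_range]
  have hcong : ∀ i ∈ Finset.range (N + 1),
      (if h : i < N + 1 then (if n ≤ ((⟨i, h⟩ : Fin (N + 1)) : ℕ) then
        hopProb p γ ((⟨i, h⟩ : Fin (N + 1)) : ℕ) N else 0) else 0) =
      if n ≤ i then hopProb p γ i N else 0 := by
    intro i hi
    rw [dif_pos (Finset.mem_range.1 hi)]
  rw [Finset.sum_congr rfl hcong]
  obtain ⟨d, rfl⟩ := Nat.exists_eq_add_of_le hN
  -- the last term is the tail at `n = N`, and each earlier term is a difference of tails
  have : ∀ m ≤ n + d, ∑ i ∈ Finset.range m, (if n ≤ i then hopProb p γ i (n + d) else 0) =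
      if n ≤ m then p * (p * γ) ^ (n - 1) - p * (p * γ) ^ (m - 1) else 0 := by
    intro m
    induction m with
    | zero => intro _; simp; omega
    | succ m ih =>
      intro hm
      rw [Finset.sum_range_succ, ih (by omega)]
      by_cases h1 : n ≤ m
      · obtain ⟨m', rfl⟩ : ∃ m', m = m' + 1 := ⟨m - 1, by omega⟩
        simp [h1, show n ≤ m' + 1 + 1 by omega, hopProb, show m' + 1 < n + d by omega,
          show n ≠ 0 by omega]
        ring
      · by_cases h2 : n = m + 1
        · simp [h2]
        · simp [h1, show ¬ n ≤ m + 1 by omega]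
  rw [Finset.sum_range_succ, this _ le_rfl]
  simp [hopProb, show n ≠ 0 by omega]

theorem sum_hopProb (p γ : ℝ) (N : ℕ) : ∑ k : Fin (N + 1), hopProb p γ k N = 1 := by
  rcases Nat.eq_zero_or_pos N with rfl | hN
  · simp [hopProb]
  · have h1 := hopProb_tail p γ le_rfl hN
    rw [Fin.sum_univ_succ] at h1 ⊢
    simp only [Fin.val_zero, Fin.val_succ] at h1 ⊢
    simp only [show ¬ (1 ≤ 0) by omega, if_false, Nat.le_add_left, if_true, zero_add, Nat.sub_self,
      pow_zero, mul_one] at h1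
    rw [h1]
    simp [hopProb, hN.ne']

theorem sum_outcomeProb {L : ℕ} [NeZero L] (p γ : ℝ) (τ : Config L) :
    ∑ k : Outcome τ, outcomeProb p γ τ k = 1 := by
  have := Finset.prod_univ_sum
    (fun h : Hole τ => (Finset.univ : Finset (Fin (blockLength τ h + 1))))
    (fun h k => hopProb p γ k (blockLength τ h))
  rw [Fintype.piFinset_univ] at this
  unfold outcomeProb
  rw [← this]
  exact Finset.prod_eq_one fun h _ => sum_hopProb p γ _

theorem sum_W {L : ℕ} [NeZero L] (p γ : ℝ) (τ : Config L) : ∑ τ', W p γ τ τ' = 1 := by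
  unfold W
  rw [Finset.sum_comm, ← sum_outcomeProb p γ τ]
  refine Finset.sum_congr rfl fun k _ => ?_
  simp

theorem siteProb_nonneg {L : ℕ} {p γ : ℝ} (hp0 : 0 < p) (hp1 : p < 1) (hγ0 : 0 ≤ γ)
    (hpγ : p * γ < 1) (τ u : Config L) (x : ZMod L) : 0 ≤ siteProb p γ τ u x := by
  unfold siteProb
  have := mul_nonneg hp0.le hγ0
  split_ifs <;> linarith

theorem W_nonneg {L : ℕ} [NeZero L] {p γ : ℝ} (hp0 : 0 < p) (hp1 : p < 1) (hγ0 : 0 ≤ γ)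
    (hpγ : p * γ < 1) (τ τ' : Config L) : 0 ≤ W p γ τ τ' := by
  rw [W_eq_sum]
  refine Finset.sum_nonneg fun u _ => ?_
  split_ifs
  · exact Finset.prod_nonneg fun x _ => siteProb_nonneg hp0 hp1 hγ0 hpγ τ u x
  · exact le_rfl

/-! ### Stationarity of the block weights -/

/-- The number of nonempty blocks, counted by the bonds where an occupied site is followed by an
empty one. -/
def blocks {L : ℕ} [NeZero L] (τ : Config L) : ℕ :=
  (Finset.univ.filter fun x : ZMod L => τ x = true ∧ τ (x + 1) = false).card

/-- The stationary weight of a nonempty block. -/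
noncomputable def blockWeight (p γ : ℝ) : ℝ := (1 - p * γ) / (1 - p)

/-- The mirror image of a configuration. -/
def mirror {L : ℕ} (τ : Config L) : Config L := fun x => τ (-x)

/-- The number of adjacent pairs of each type is the same in a configuration and in its mirror
image, hence so is every product over the bonds of this form. -/
theorem prod_bonds_reflect {L : ℕ} [NeZero L] (α β : ℝ) (f : Config L) (a : ZMod L) :
    (∏ x, if f (a - x) = true then (if f (a - (x + 1)) = true then α else β) else 1) =
      ∏ x, if f x = true then (if f (x + 1) = true then α else β) else 1 := by
  have key : ∀ g : Config L,
      (∏ x, if f x = true then (if g x = true then α else β) else 1) =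
        α ^ (Finset.univ.filter fun x => f x = true ∧ g x = true).card *
        β ^ ((Finset.univ.filter fun x => f x = true).card -
          (Finset.univ.filter fun x => f x = true ∧ g x = true).card) := by
    intro g
    rw [← Finset.prod_filter, Finset.prod_ite, Finset.prod_const, Finset.prod_const,
      Finset.filter_filter]
    congr 2
    have := Finset.card_filter_add_card_filter_not
      (s := Finset.univ.filter fun x => f x = true) (fun x => g x = true)
    rw [Finset.filter_filter] at this
    omega
  have hl := (Equiv.subLeft a).prod_comp
    (fun x => if f x = true then (if f (x - 1) = true then α else β) else 1)
  simp only [Equiv.subLeft_apply, sub_sub] at hl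
  rw [hl, key fun x => f (x - 1), key fun x => f (x + 1)]
  have hc : (Finset.univ.filter fun x => f x = true ∧ f (x - 1) = true).card =
      (Finset.univ.filter fun x => f x = true ∧ f (x + 1) = true).card := by
    refine Finset.card_bij' (fun x _ => x - 1) (fun x _ => x + 1) ?_ ?_ ?_ ?_ <;>
      simp +contextual
  rw [hc]

theorem pow_blocks {L : ℕ} [NeZero L] (c : ℝ) (τ : Config L) :
    c ^ blocks τ = ∏ x, if τ x = true then (if τ (x + 1) = true then 1 else c) else 1 := by
  rw [blocks, ← Finset.prod_const, Finset.prod_filter]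
  refine Finset.prod_congr rfl fun x _ => ?_
  cases τ x <;> cases τ (x + 1) <;> simp

theorem pow_blocks_mirror {L : ℕ} [NeZero L] (c : ℝ) (τ : Config L) :
    c ^ blocks (mirror τ) = c ^ blocks τ := by
  rw [pow_blocks, pow_blocks, ← prod_bonds_reflect 1 c τ 0]
  simp [mirror]

/-- The hopping particles and the staying ones enter the weighted hopping probability through
their runs only. -/
theorem pow_blocks_mul_prod_siteProb {L : ℕ} [NeZero L] {p γ : ℝ} (hp1 : p < 1) (τ u : Config L)
    (hu : Valid τ u) :
    blockWeight p γ ^ blocks τ * ∏ x, siteProb p γ τ u x =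
      (∏ x, if u x = true then (if u (x + 1) = true then p * γ else p * blockWeight p γ) else 1) *
      ∏ x, if (τ x && !u x) = true then
        (if (τ (x + 1) && !u (x + 1)) = true then 1 else 1 - p * γ) else 1 := by
  rw [pow_blocks, ← Finset.prod_mul_distrib, ← Finset.prod_mul_distrib]
  refine Finset.prod_congr rfl fun x _ => ?_
  have h1 := hu.1 x
  have h2 := hu.1 (x + 1)
  have hc : blockWeight p γ * (1 - p) = 1 - p * γ :=
    div_mul_cancel₀ _ (by linarith)
  have hc' : blockWeight p γ * p = p * blockWeight p γ := mul_comm _ _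
  unfold siteProb
  cases hτ : τ x <;> cases hτ' : τ (x + 1) <;> cases hux : u x <;> cases hux' : u (x + 1) <;>
    simp_all

/-- The time-reversed marking, seen in the mirror: the particle that hopped from `x` to `x + 1`
sits at `-(x + 1)` in the mirror image of the new configuration, and hops to `-x`. -/
def reverseMarks {L : ℕ} (u : Config L) : Config L := fun x => u (-x - 1)

theorem reverseMarks_involutive {L : ℕ} :
    Function.Involutive (reverseMarks : Config L → Config L) := by
  intro u
  funext x
  simp [reverseMarks]

theorem mirror_involutive {L : ℕ} : Function.Involutive (mirror : Config L → Config L) := by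
  intro u
  funext x
  simp [mirror]

theorem Valid.reverse {L : ℕ} {τ u : Config L} (hu : Valid τ u) :
    Valid (mirror (move τ u)) (reverseMarks u) ∧
      move (mirror (move τ u)) (reverseMarks u) = mirror τ ∧
      ∀ x, (mirror (move τ u) x && !reverseMarks u x) = (τ (-x) && !u (-x)) := by
  refine ⟨⟨fun x hx => ?_, ?_⟩, ?_, ?_⟩
  · simp only [reverseMarks, mirror, move] at hx ⊢
    rw [show -(x + 1) = -x - 1 by ring]
    simp [hx]
  · obtain ⟨y, hy⟩ := hu.2
    exact ⟨-y - 1, by simpa [reverseMarks] using hy⟩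
  · funext x
    have h1 := hu.1 (-x)
    have h2 := hu.1 (-x - 1)
    simp only [reverseMarks, mirror, move]
    rw [show -(x - 1) - 1 = -x by ring]
    rw [sub_add_cancel] at h2
    cases hτ : τ (-x) <;> cases hux : u (-x) <;> cases hux' : u (-x - 1) <;> simp_all
  · intro x
    have h2 := hu.1 (-x - 1)
    simp only [reverseMarks, mirror, move]
    rw [sub_add_cancel] at h2
    cases hτ : τ (-x) <;> cases hux : u (-x) <;> cases hux' : u (-x - 1) <;> simp_all

theorem weight_reverse {L : ℕ} [NeZero L] {p γ : ℝ} (hp1 : p < 1) {τ u : Config L}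
    (hu : Valid τ u) :
    blockWeight p γ ^ blocks τ * ∏ x, siteProb p γ τ u x =
      blockWeight p γ ^ blocks (move τ u) *
        ∏ x, siteProb p γ (mirror (move τ u)) (reverseMarks u) x := by
  obtain ⟨h1, -, h3⟩ := hu.reverse
  rw [← pow_blocks_mirror _ (move τ u), pow_blocks_mul_prod_siteProb hp1 τ u hu,
    pow_blocks_mul_prod_siteProb hp1 _ _ h1]
  simp_rw [h3]
  congr 1
  · rw [← prod_bonds_reflect _ _ u (-1)]
    simp only [reverseMarks, ← neg_add', add_comm]
  · rw [← prod_bonds_reflect _ _ (fun x => τ x && !u x) 0]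
    simp only [zero_sub]

/-- Duality: the time-reversed process is the mirror image of the process itself. -/
theorem pow_blocks_mul_W {L : ℕ} [NeZero L] {p γ : ℝ} (hp1 : p < 1) (τ τ' : Config L) :
    blockWeight p γ ^ blocks τ * W p γ τ τ' =
      blockWeight p γ ^ blocks τ' * W p γ (mirror τ') (mirror τ) := by
  rw [W_eq_sum, W_eq_sum, ← reverseMarks_involutive.bijective.sum_comp, Finset.mul_sum,
    Finset.mul_sum]
  refine Finset.sum_congr rfl fun u _ => ?_
  have hiff : (Valid τ (reverseMarks u) ∧ move τ (reverseMarks u) = τ') ↔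
      (Valid (mirror τ') u ∧ move (mirror τ') u = mirror τ) := by
    constructor
    · rintro ⟨h, rfl⟩
      have := h.reverse
      rw [reverseMarks_involutive] at this
      exact ⟨this.1, this.2.1⟩
    · rintro ⟨h, he⟩
      have := h.reverse
      rw [he, mirror_involutive, mirror_involutive] at this
      exact ⟨this.1, this.2.1⟩
  by_cases h : Valid τ (reverseMarks u) ∧ move τ (reverseMarks u) = τ'
  · rw [if_pos h, if_pos (hiff.1 h)]
    have := weight_reverse (γ := γ) hp1 h.1
    rwa [h.2, reverseMarks_involutive] at this
  · rw [if_neg h, if_neg fun h' => h (hiff.2 h'), mul_zero, mul_zero]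

theorem sum_pow_blocks_mul_W {L : ℕ} [NeZero L] {p γ : ℝ} (hp1 : p < 1) (τ : Config L) :
    ∑ τ', blockWeight p γ ^ blocks τ' * W p γ τ' τ = blockWeight p γ ^ blocks τ := by
  simp_rw [pow_blocks_mul_W hp1 _ τ]
  rw [← Finset.mul_sum, mirror_involutive.bijective.sum_comp fun τ' => W p γ (mirror τ) τ', sum_W,
    mul_one]

/-! ### Irreducibility on the configurations with a given number of particles -/

theorem natCast_particleCount {L : ℕ} [NeZero L] (τ : Config L) :
    (particleCount τ : ℤ) = ∑ x, if τ x = true then 1 else 0 := by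
  simp [particleCount]

theorem particleCount_move {L : ℕ} [NeZero L] {τ u : Config L} (hu : Valid τ u) :
    particleCount (move τ u) = particleCount τ := by
  zify
  rw [natCast_particleCount, natCast_particleCount]
  have h : ∀ x, (if move τ u x = true then (1 : ℤ) else 0) = (if τ x = true then 1 else 0) -
      (if u x = true then 1 else 0) + if u (x - 1) = true then 1 else 0 := by
    intro x
    have h1 := hu.1 x
    have h2 := hu.1 (x - 1)
    rw [sub_add_cancel] at h2
    unfold move
    cases hτ : τ x <;> cases hux : u x <;> cases hux' : u (x - 1) <;> simp_all
  have hs := (Equiv.subRight (1 : ZMod L)).sum_comp fun x => if u x = true then (1 : ℤ) else 0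
  simp only [Equiv.subRight_apply] at hs
  simp_rw [h]
  rw [Finset.sum_add_distrib, Finset.sum_sub_distrib, hs]
  ring

theorem particleCount_eq_of_W_ne_zero {L : ℕ} [NeZero L] {p γ : ℝ} {τ τ' : Config L}
    (h : W p γ τ τ' ≠ 0) : particleCount τ' = particleCount τ := by
  rw [W_eq_sum] at h
  obtain ⟨u, -, hu⟩ := Finset.exists_ne_zero_of_sum_ne_zero h
  have h' : Valid τ u ∧ move τ u = τ' := by
    by_contra hc
    exact hu (if_neg hc)
  rw [← h'.2, particleCount_move h'.1]

/-- A single particle with an empty site in front of it may move alone. -/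
theorem W_swap_pos {L : ℕ} [NeZero L] {p γ : ℝ} (hp0 : 0 < p) (hp1 : p < 1) (hγ0 : 0 ≤ γ)
    (hpγ : p * γ < 1) {τ : Config L} {x : ZMod L} (hx : τ x = true) (hx' : τ (x + 1) = false) :
    0 < W p γ τ (τ ∘ Equiv.swap x (x + 1)) := by
  have hne : x + 1 ≠ x := by
    intro h
    rw [h, hx] at hx'
    cases hx'
  set u : Config L := fun y => decide (y = x) with hu
  have hv : Valid τ u := by
    refine ⟨fun y hy => ?_, x + 1, by simpa [hu] using hne⟩
    have : y = x := by simpa [hu] using hy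
    subst this
    simp [hx, hx']
  have hm : move τ u = τ ∘ Equiv.swap x (x + 1) := by
    funext y
    simp only [move, hu, Function.comp]
    by_cases h1 : y = x
    · subst h1
      have : y - 1 ≠ y := fun h => hne (by linear_combination -h)
      simp [hx', hx, this]
    · by_cases h2 : y = x + 1
      · subst h2
        simp [hx]
      · have : y - 1 ≠ x := fun h => h2 (by linear_combination h)
        simp [Equiv.swap_apply_of_ne_of_ne h1 h2, h1, this]
  rw [W_eq_sum]
  refine lt_of_lt_of_le ?_ (Finset.single_le_sum (f := fun u : Config L =>
    if Valid τ u ∧ move τ u = τ ∘ Equiv.swap x (x + 1) then ∏ x, siteProb p γ τ u x else 0)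
    (fun v _ => ?_) (Finset.mem_univ u))
  · rw [if_pos ⟨hv, hm⟩]
    refine Finset.prod_pos fun y _ => ?_
    have h1 := hv.1 y
    unfold siteProb
    have hyx : u y = true → τ (y + 1) = false := by
      intro hy
      have : y = x := by simpa [hu] using hy
      rw [this, hx']
    split_ifs with h2 h3 h4 <;> first | linarith | skip
    rw [hyx h4] at h3
    cases h3
  · split_ifs
    · exact Finset.prod_nonneg fun x _ => siteProb_nonneg hp0 hp1 hγ0 hpγ τ v x
    · exact le_rfl

/-- Adjacent exchanges connect all configurations with the same number of particles. -/
theorem eq_of_swap_invariant {L : ℕ} [NeZero L] {g : Config L → ℝ}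
    (hg : ∀ (τ : Config L) (x : ZMod L), τ x = true → τ (x + 1) = false →
      g (τ ∘ Equiv.swap x (x + 1)) = g τ)
    {τ τ' : Config L} (h : particleCount τ = particleCount τ') : g τ = g τ' := by
  have hadj : ∀ (x : ZMod L) (τ : Config L), g (τ ∘ Equiv.swap x (x + 1)) = g τ := by
    intro x τ
    have hsame : τ x = τ (x + 1) → τ ∘ Equiv.swap x (x + 1) = τ := by
      intro he
      funext y
      simp only [Function.comp]
      by_cases h1 : y = x
      · subst h1; simp [he]
      · by_cases h2 : y = x + 1
        · subst h2; simp [he]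
        · rw [Equiv.swap_apply_of_ne_of_ne h1 h2]
    cases h1 : τ x <;> cases h2 : τ (x + 1)
    · rw [hsame (h1.trans h2.symm)]
    · have := hg (τ ∘ Equiv.swap x (x + 1)) x (by simpa using h2) (by simpa using h1)
      rw [← this, Function.comp_assoc]
      congr 1
      funext y
      simp
    · exact hg τ x h1 h2
    · rw [hsame (h1.trans h2.symm)]
  have hfar : ∀ (i : ℕ) (x : ZMod L) (τ : Config L), g (τ ∘ Equiv.swap x (x + i)) = g τ := by
    intro i x
    induction i with
    | zero => intro τ; simp
    | succ i ih =>
      intro τ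
      by_cases h1 : x = x + i
      · rw [← h1] at ih
        have := hadj x τ
        rwa [show x + ((i + 1 : ℕ) : ZMod L) = x + 1 by push_cast; linear_combination -h1]
      by_cases h2 : x = x + i + 1
      · rw [show x + ((i + 1 : ℕ) : ZMod L) = x by push_cast; linear_combination -h2]
        simp
      -- conjugating the shorter exchange by an adjacent one
      have hconj : Equiv.swap x (x + ((i + 1 : ℕ) : ZMod L)) = Equiv.swap (x + i) (x + i + 1) *
          Equiv.swap x (x + i) * Equiv.swap (x + i) (x + i + 1) := by
        rw [Equiv.swap_mul_swap_mul_swap h1 h2, Equiv.swap_comm]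
        push_cast
        rw [add_assoc]
      rw [hconj, Equiv.Perm.coe_mul, Equiv.Perm.coe_mul, ← Function.comp_assoc,
        ← Function.comp_assoc, hadj, ih, hadj]
  have hall : ∀ (e : Equiv.Perm (ZMod L)) (τ : Config L), g (τ ∘ e) = g τ := by
    intro e
    induction e using Equiv.Perm.swap_induction_on with
    | one => intro τ; rfl
    | swap_mul e x y _ ih =>
      intro τ
      have := hfar (y - x).val x τ
      rw [ZMod.natCast_zmod_val, add_sub_cancel] at this
      rw [Equiv.Perm.coe_mul, ← Function.comp_assoc, ih, this]
  have hcard : ∀ b : Bool, Fintype.card {x // τ x = b} = Fintype.card {x // τ' x = b} := by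
    have ht : Fintype.card {x // τ x = true} = Fintype.card {x // τ' x = true} := by
      rw [Fintype.card_subtype, Fintype.card_subtype]
      exact h
    intro b
    cases b
    · have h1 := Fintype.card_subtype_compl (fun x => τ x = true)
      have h2 := Fintype.card_subtype_compl (fun x => τ' x = true)
      simp only [Bool.not_eq_true] at h1 h2
      rw [h1, h2, ht]
    · exact ht
  have he : τ = τ' ∘ Equiv.ofFiberEquiv fun b => Fintype.equivOfCardEq (hcard b) :=
    funext fun x => (Equiv.ofFiberEquiv_map _ x).symm
  rw [he, hall]

/-! ### The stationary measure -/

/-- The partition function of the ring with `N` particles. -/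
noncomputable def partition (L : ℕ) [NeZero L] (p γ : ℝ) (N : ℕ) : ℝ :=
  ∑ τ : Config L, if particleCount τ = N then blockWeight p γ ^ blocks τ else 0

/-- The canonical Gibbs measure with `N` particles, in which each nonempty block has the weight
`blockWeight p γ`. -/
noncomputable def gibbs {L : ℕ} [NeZero L] (p γ : ℝ) (N : ℕ) (τ : Config L) : ℝ :=
  if particleCount τ = N then blockWeight p γ ^ blocks τ / partition L p γ N else 0

theorem blockWeight_pos {p γ : ℝ} (hp1 : p < 1) (hpγ : p * γ < 1) : 0 < blockWeight p γ :=
  div_pos (by linarith) (by linarith)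

theorem partition_pos {L : ℕ} [NeZero L] {p γ : ℝ} (hp1 : p < 1) (hpγ : p * γ < 1) {N : ℕ}
    (hN : N ≤ L) : 0 < partition L p γ N := by
  have hc := blockWeight_pos hp1 hpγ
  obtain ⟨t, -, ht⟩ := Finset.exists_subset_card_eq
    (s := (Finset.univ : Finset (ZMod L))) (n := N) (by simpa [ZMod.card] using hN)
  refine Finset.sum_pos' (fun τ _ => ?_) ⟨fun x => decide (x ∈ t), Finset.mem_univ _, ?_⟩
  · split_ifs
    · positivity
    · exact le_rfl
  · rw [if_pos (by simp [particleCount, ht])]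
    positivity

/-- The balance equations with the diagonal terms restored, and extended to the configurations with
other particle numbers. -/
theorem IsStationaryMeasure.sum_mul_W {L : ℕ} [NeZero L] {p γ : ℝ} {N : ℕ} {P : Config L → ℝ}
    (hP : IsStationaryMeasure p γ N P) (τ : Config L) : ∑ τ', P τ' * W p γ τ' τ = P τ := by
  by_cases hτ : particleCount τ = N
  · have hb := hP.balance τ hτ
    simp only [Finset.filter_ne'] at hb
    have h1 : W p γ τ τ * P τ + ∑ τ' ∈ Finset.univ.erase τ, W p γ τ τ' * P τ = P τ := by
      rw [Finset.add_sum_erase Finset.univ (fun τ' => W p γ τ τ' * P τ) (Finset.mem_univ τ),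
        ← Finset.sum_mul, sum_W, one_mul]
    have h2 := Finset.add_sum_erase Finset.univ (fun τ' => W p γ τ' τ * P τ') (Finset.mem_univ τ)
    simp_rw [mul_comm (P _)]
    rw [← h2, ← hb, h1]
  · rw [hP.support τ hτ]
    refine Finset.sum_eq_zero fun τ' _ => ?_
    by_cases hτ' : particleCount τ' = N
    · by_cases hW : W p γ τ' τ = 0
      · rw [hW, mul_zero]
      · exact absurd ((particleCount_eq_of_W_ne_zero hW).trans hτ') hτ
    · rw [hP.support τ' hτ', zero_mul]

theorem gibbs_isStationaryMeasure {L : ℕ} [NeZero L] {p γ : ℝ} (hp1 : p < 1) (hpγ : p * γ < 1)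
    {N : ℕ} (hN : N ≤ L) : IsStationaryMeasure p γ N (gibbs p γ N : Config L → ℝ) := by
  have hc := blockWeight_pos hp1 hpγ
  have hZ := partition_pos (L := L) hp1 hpγ hN
  refine ⟨fun τ => ?_, fun τ hτ => if_neg hτ, ?_, fun τ hτ => ?_⟩
  · unfold gibbs
    split_ifs
    · positivity
    · exact le_rfl
  · have : ∀ τ : Config L, gibbs p γ N τ =
        (if particleCount τ = N then blockWeight p γ ^ blocks τ else 0) / partition L p γ N := by
      intro τ
      unfold gibbs
      split_ifs <;> simp
    simp_rw [this]
    rw [← Finset.sum_div]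
    exact div_self hZ.ne'
  · have hst : ∑ τ', W p γ τ' τ * gibbs p γ N τ' = gibbs p γ N τ := by
      have : ∀ τ', W p γ τ' τ * gibbs p γ N τ' =
          blockWeight p γ ^ blocks τ' * W p γ τ' τ / partition L p γ N := by
        intro τ'
        by_cases hW : W p γ τ' τ = 0
        · simp [hW]
        · rw [gibbs, if_pos ((particleCount_eq_of_W_ne_zero hW).symm.trans hτ)]
          ring
      simp_rw [this]
      rw [← Finset.sum_div, sum_pow_blocks_mul_W hp1, gibbs, if_pos hτ]
    simp only [Finset.filter_ne']
    have h1 : W p γ τ τ * gibbs p γ N τ +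
        ∑ τ' ∈ Finset.univ.erase τ, W p γ τ τ' * gibbs p γ N τ = gibbs p γ N τ := by
      rw [Finset.add_sum_erase Finset.univ (fun τ' => W p γ τ τ' * gibbs p γ N τ)
        (Finset.mem_univ τ), ← Finset.sum_mul, sum_W, one_mul]
    have h2 := Finset.add_sum_erase Finset.univ
      (fun τ' => W p γ τ' τ * gibbs p γ N τ') (Finset.mem_univ τ)
    linarith

/-- The density of a stationary measure with respect to the Gibbs weights has vanishing Dirichlet
form, so it is constant along all transitions. -/
theorem IsStationaryMeasure.eq_gibbs {L : ℕ} [NeZero L] {p γ : ℝ} (hp0 : 0 < p) (hp1 : p < 1)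
    (hγ0 : 0 ≤ γ) (hpγ : p * γ < 1) {N : ℕ} {P : Config L → ℝ}
    (hP : IsStationaryMeasure p γ N P) : P = gibbs p γ N := by
  have hc := blockWeight_pos hp1 hpγ
  set Q : Config L → ℝ := fun τ => blockWeight p γ ^ blocks τ with hQ
  have hQpos : ∀ τ, 0 < Q τ := fun τ => pow_pos hc _
  set g : Config L → ℝ := fun τ => P τ / Q τ with hg
  have hPg : ∀ τ, P τ = Q τ * g τ := fun τ => (mul_div_cancel₀ _ (hQpos τ).ne').symm
  have hQW : ∀ τ, ∑ τ', Q τ' * W p γ τ' τ = Q τ := sum_pow_blocks_mul_W hp1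
  have hdir : ∑ τ, ∑ τ', Q τ' * W p γ τ' τ * (g τ' - g τ) ^ 2 = 0 := by
    have h1 : ∀ τ τ', Q τ' * W p γ τ' τ * (g τ' - g τ) ^ 2 =
        Q τ' * g τ' ^ 2 * W p γ τ' τ - 2 * g τ * (P τ' * W p γ τ' τ) +
          g τ ^ 2 * (Q τ' * W p γ τ' τ) := by
      intro τ τ'
      rw [hPg τ']
      ring
    simp_rw [h1, Finset.sum_add_distrib, Finset.sum_sub_distrib, ← Finset.mul_sum, hP.sum_mul_W,
      hQW]
    rw [Finset.sum_comm]
    simp_rw [← Finset.mul_sum, sum_W, hPg]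
    rw [← Finset.sum_sub_distrib, ← Finset.sum_add_distrib]
    exact Finset.sum_eq_zero fun τ _ => by ring
  have hterm : ∀ τ τ', 0 ≤ Q τ' * W p γ τ' τ * (g τ' - g τ) ^ 2 := fun τ τ' =>
    mul_nonneg (mul_nonneg (hQpos τ').le (W_nonneg hp0 hp1 hγ0 hpγ _ _)) (sq_nonneg _)
  have hconst : ∀ τ τ', 0 < W p γ τ' τ → g τ = g τ' := by
    intro τ τ' hW
    have h1 := (Finset.sum_eq_zero_iff_of_nonneg fun τ _ =>
      Finset.sum_nonneg fun τ' _ => hterm τ τ').1 hdir τ (Finset.mem_univ _)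
    have h2 := (Finset.sum_eq_zero_iff_of_nonneg fun τ' _ => hterm τ τ').1 h1 τ'
      (Finset.mem_univ _)
    have h3 : (g τ' - g τ) ^ 2 = 0 :=
      (mul_eq_zero.1 h2).resolve_left (mul_pos (hQpos τ') hW).ne'
    have := pow_eq_zero_iff (two_ne_zero) |>.1 h3
    linarith
  have hsec : ∀ τ τ', particleCount τ = particleCount τ' → g τ = g τ' := fun τ τ' h =>
    eq_of_swap_invariant (fun τ x hx hx' => hconst _ _ (W_swap_pos hp0 hp1 hγ0 hpγ hx hx')) h
  funext τ
  by_cases hτ : particleCount τ = N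
  · have htot : g τ * partition L p γ N = 1 := by
      rw [← hP.total, partition, Finset.mul_sum]
      refine Finset.sum_congr rfl fun τ' _ => ?_
      by_cases hτ' : particleCount τ' = N
      · rw [if_pos hτ', hPg τ', hsec τ τ' (hτ.trans hτ'.symm), mul_comm]
      · rw [if_neg hτ', hP.support τ' hτ', mul_zero]
    rw [gibbs, if_pos hτ, hPg τ, eq_one_div_of_mul_eq_one_left htot]
    ring
  · rw [gibbs, if_neg hτ, hP.support τ hτ]

/-! ### Reversal of segments -/

/-- The reflection of the `m + 1` sites `o, o + 1, …, o + m`; the other sites stay fixed. -/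
def reflect {L : ℕ} (o : ZMod L) (m : ℕ) (x : ZMod L) : ZMod L :=
  if (x - o).val ≤ m then o + o + m - x else x

theorem reflect_of_le {L : ℕ} (o : ZMod L) {m i : ℕ} (hm : m < L) (hi : i ≤ m) :
    reflect o m (o + i) = o + ((m - i : ℕ) : ZMod L) := by
  rw [reflect, add_sub_cancel_left, ZMod.val_natCast_of_lt (by omega), if_pos hi, Nat.cast_sub hi]
  ring

theorem reflect_of_lt {L : ℕ} (o : ZMod L) {m i : ℕ} (hi : m < i) (hiL : i < L) :
    reflect o m (o + i) = o + i := by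
  rw [reflect, add_sub_cancel_left, ZMod.val_natCast_of_lt hiL, if_neg (by omega)]

theorem exists_eq_add_natCast {L : ℕ} [NeZero L] (o x : ZMod L) :
    ∃ i < L, x = o + (i : ZMod L) :=
  ⟨(x - o).val, ZMod.val_lt _, by simp⟩

theorem reflect_involutive {L : ℕ} [NeZero L] (o : ZMod L) {m : ℕ} (hm : m < L) :
    Function.Involutive (reflect o m) := by
  intro x
  obtain ⟨i, hi, rfl⟩ := exists_eq_add_natCast o x
  by_cases him : i ≤ m
  · rw [reflect_of_le o hm him, reflect_of_le o hm (by omega), show m - (m - i) = i by omega]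
  · rw [reflect_of_lt o (by omega) hi, reflect_of_lt o (by omega) hi]

/-- The configuration with the segment at `o + 1, …, o + y` reversed. -/
def segRev {L : ℕ} (o : ZMod L) (y : ℕ) (τ : Config L) : Config L :=
  fun x => τ (reflect (o + 1) (y - 1) x)

theorem segRev_of_le {L : ℕ} (o : ZMod L) {y j : ℕ} (τ : Config L) (hy : y < L) (hj : 1 ≤ j)
    (hjy : j ≤ y) : segRev o y τ (o + j) = τ (o + ((y + 1 - j : ℕ) : ZMod L)) := by
  have h : o + (j : ZMod L) = o + 1 + ((j - 1 : ℕ) : ZMod L) := by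
    rw [Nat.cast_sub hj]; push_cast; ring
  have h' : o + 1 + ((y - 1 - (j - 1) : ℕ) : ZMod L) = o + ((y + 1 - j : ℕ) : ZMod L) := by
    rw [show y + 1 - j = (y - 1 - (j - 1)) + 1 by omega]; push_cast; ring
  rw [segRev, h, reflect_of_le (o + 1) (by omega) (by omega), h']

theorem segRev_of_lt {L : ℕ} (o : ZMod L) {y j : ℕ} (τ : Config L) (hy : 1 ≤ y) (hj : y < j)
    (hjL : j ≤ L) : segRev o y τ (o + j) = τ (o + j) := by
  have h : o + (j : ZMod L) = o + 1 + ((j - 1 : ℕ) : ZMod L) := by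
    rw [Nat.cast_sub (by omega)]; push_cast; ring
  rw [segRev, h, reflect_of_lt (o + 1) (by omega) (by omega)]

theorem segRev_self {L : ℕ} (o : ZMod L) {y : ℕ} (τ : Config L) (hy : 1 ≤ y) (hyL : y < L) :
    segRev o y τ o = τ o := by
  simpa using segRev_of_lt o τ hy hyL le_rfl

theorem segRev_involutive {L : ℕ} [NeZero L] (o : ZMod L) {y : ℕ} (hy : y < L) :
    Function.Involutive (segRev o y) := by
  intro τ
  funext x
  simp only [segRev]
  rw [reflect_involutive (o + 1) (by omega)]

theorem particleCount_segRev {L : ℕ} [NeZero L] (o : ZMod L) {y : ℕ} (hy : y < L)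
    (τ : Config L) : particleCount (segRev o y τ) = particleCount τ := by
  zify
  rw [natCast_particleCount, natCast_particleCount]
  exact (reflect_involutive (o + 1) (m := y - 1) (by omega)).bijective.sum_comp
    fun x => if τ x = true then (1 : ℤ) else 0

theorem sum_shift {L : ℕ} [NeZero L] {M : Type*} [AddCommMonoid M] (t : ZMod L) (f : ZMod L → M) :
    ∑ x, f (x + t) = ∑ x, f x :=
  (AddGroup.addRight_bijective t).sum_comp f

/-- Around the ring, bonds `10` and bonds `01` are equally many. -/
theorem two_mul_blocks {L : ℕ} [NeZero L] (τ : Config L) :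
    2 * (blocks τ : ℤ) = ∑ x, if τ x = τ (x + 1) then 0 else 1 := by
  have h1 : (blocks τ : ℤ) = ∑ x, if τ x = true ∧ τ (x + 1) = false then 1 else 0 := by
    simp [blocks]
  have hs := sum_shift 1 fun x => if τ x = true then (1 : ℤ) else 0
  have h2 : ∀ x, (if τ x = τ (x + 1) then (0 : ℤ) else 1) =
      2 * (if τ x = true ∧ τ (x + 1) = false then 1 else 0) +
        (if τ (x + 1) = true then 1 else 0) - (if τ x = true then 1 else 0) := by
    intro x
    cases τ x <;> cases τ (x + 1) <;> simp
  simp_rw [h2]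
  rw [Finset.sum_sub_distrib, Finset.sum_add_distrib, hs, ← Finset.mul_sum, h1]
  ring

/-- Reversing a segment changes the bonds at its two ends only. -/
theorem two_mul_blocks_segRev {L : ℕ} [NeZero L] (o : ZMod L) {y : ℕ} (hy : 1 ≤ y) (hyL : y < L)
    (τ : Config L) :
    2 * (blocks (segRev o y τ) : ℤ) - 2 * blocks τ =
      ((if τ (o + 1) = τ (o + y + 1) then 0 else 1) - if τ o = τ (o + 1) then 0 else 1) +
      ((if τ o = τ (o + y) then 0 else 1) - if τ (o + y) = τ (o + y + 1) then 0 else 1) := by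
  rw [two_mul_blocks, two_mul_blocks, ← (reflect_involutive o hyL).bijective.sum_comp,
    ← Finset.sum_sub_distrib]
  have hne : o ≠ o + (y : ZMod L) := by
    intro h
    have h0 : (y : ZMod L) = 0 := by simpa using h.symm
    have := congrArg ZMod.val h0
    rw [ZMod.val_natCast_of_lt hyL, ZMod.val_zero] at this
    omega
  have hlast : segRev o y τ (o + y + 1) = τ (o + y + 1) := by
    have := segRev_of_lt o τ hy (Nat.lt_succ_self y) hyL
    push_cast at this
    rwa [← add_assoc] at this
  have hfirst : segRev o y τ (o + 1) = τ (o + y) := by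
    have := segRev_of_le o τ hyL le_rfl hy
    simpa using this
  have hyth : segRev o y τ (o + y) = τ (o + 1) := by
    have := segRev_of_le o τ hyL hy le_rfl
    simpa using this
  have h0 : reflect o y o = o + y := by simpa using reflect_of_le o hyL (Nat.zero_le y)
  have h1 : reflect o y (o + y) = o := by simpa using reflect_of_le o hyL (le_refl y)
  rw [Fintype.sum_eq_add o (o + (y : ZMod L)) hne]
  · rw [h0, h1, hlast, hfirst, hyth, segRev_self o τ hy hyL]
  · rintro x ⟨hx, hx'⟩
    obtain ⟨i, hi, rfl⟩ := exists_eq_add_natCast o x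
    have hi0 : i ≠ 0 := by rintro rfl; simp at hx
    have hiy : i ≠ y := by rintro rfl; simp at hx'
    by_cases hlt : i < y
    · have e1 : o + ((y - i : ℕ) : ZMod L) + 1 = o + ((y - i + 1 : ℕ) : ZMod L) := by
        push_cast; ring
      have e2 : o + (i : ZMod L) + 1 = o + ((i + 1 : ℕ) : ZMod L) := by push_cast; ring
      rw [reflect_of_le o hyL hlt.le, e1, e2, segRev_of_le o τ hyL (by omega) (by omega),
        segRev_of_le o τ hyL (by omega) (by omega), show y + 1 - (y - i) = i + 1 by omega,
        show y + 1 - (y - i + 1) = i by omega, sub_eq_zero]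
      simp only [eq_comm]
    · have e2 : o + (i : ZMod L) + 1 = o + ((i + 1 : ℕ) : ZMod L) := by push_cast; ring
      rw [reflect_of_lt o (by omega) hi, e2, segRev_of_lt o τ hy (by omega) (by omega),
        segRev_of_lt o τ hy (by omega) (by omega), sub_self]

theorem blocks_segRev_of_eq {L : ℕ} [NeZero L] (o : ZMod L) {y : ℕ} (hy : 1 ≤ y) (hyL : y < L)
    {τ : Config L} (h : τ o = τ (o + y + 1)) : blocks (segRev o y τ) = blocks τ := by
  have := two_mul_blocks_segRev o hy hyL τ
  rw [← h] at this
  simp only [eq_comm] at this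
  have h2 : (2 : ℤ) * blocks (segRev o y τ) - 2 * blocks τ = 0 := by
    rw [this]
    simp only [eq_comm]
    ring
  omega

/-- A segment that starts inside a block and ends inside a gap is reversed into one more block. -/
theorem blocks_segRev_of_ne {L : ℕ} [NeZero L] (o : ZMod L) {y : ℕ} (hy : 1 ≤ y) (hyL : y < L)
    {τ : Config L} (h0 : τ o = true) (h1 : τ (o + 1) = true) (h2 : τ (o + y) = false)
    (h3 : τ (o + y + 1) = false) : blocks (segRev o y τ) = blocks τ + 1 := by
  have := two_mul_blocks_segRev o hy hyL τ
  rw [h0, h1, h2, h3] at this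
  simp at this
  omega

/-! ### Counting sites and bonds -/

/-- The number of sites in the state `a`, if there are `N` particles. -/
noncomputable def siteCount (L N : ℕ) (a : Bool) : ℝ := if a = true then N else (L : ℝ) - N

theorem sum_site_eq {L : ℕ} [NeZero L] (τ : Config L) (a : Bool) :
    (∑ x, if τ x = a then (1 : ℝ) else 0) = siteCount L (particleCount τ) a := by
  have h1 : (∑ x, if τ x = true then (1 : ℝ) else 0) = particleCount τ := by
    simp [particleCount]
  cases a
  · have h2 : ∀ x, (if τ x = false then (1 : ℝ) else 0) = 1 - if τ x = true then 1 else 0 := by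
      intro x
      cases τ x <;> simp
    simp_rw [h2]
    rw [Finset.sum_sub_distrib, h1]
    simp [siteCount, ZMod.card]
  · simpa [siteCount] using h1

theorem natCast_blocks {L : ℕ} [NeZero L] (τ : Config L) :
    (blocks τ : ℝ) = ∑ x, if τ x = true ∧ τ (x + 1) = false then 1 else 0 := by
  simp [blocks]

theorem sum_bond_eq {L : ℕ} [NeZero L] (τ : Config L) (a : Bool) :
    (∑ x, if τ x = a ∧ τ (x + 1) = a then (1 : ℝ) else 0) =
      siteCount L (particleCount τ) a - blocks τ := by
  rw [← sum_site_eq, natCast_blocks]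
  cases a
  · rw [← sum_shift 1 fun x => if τ x = false then (1 : ℝ) else 0, ← Finset.sum_sub_distrib]
    refine Finset.sum_congr rfl fun x _ => ?_
    cases τ x <;> cases τ (x + 1) <;> simp
  · rw [← Finset.sum_sub_distrib]
    refine Finset.sum_congr rfl fun x _ => ?_
    cases τ x <;> cases τ (x + 1) <;> simp

theorem sum_range_eq_sum {L : ℕ} [NeZero L] (o : ZMod L) (f : ZMod L → ℝ) :
    ∑ y ∈ Finset.range L, f (o + y) = ∑ x, f x := by
  refine Finset.sum_bij (fun y _ => o + (y : ZMod L)) (fun _ _ => Finset.mem_univ _) ?_ ?_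
    fun _ _ => rfl
  · intro y hy y' hy' h
    have := congrArg ZMod.val (add_left_cancel h)
    rwa [ZMod.val_natCast_of_lt (Finset.mem_range.1 hy),
      ZMod.val_natCast_of_lt (Finset.mem_range.1 hy')] at this
  · intro x _
    obtain ⟨i, hi, rfl⟩ := exists_eq_add_natCast o x
    exact ⟨i, Finset.mem_range.2 hi, rfl⟩

theorem gibbs_congr {L : ℕ} [NeZero L] (p γ : ℝ) (N : ℕ) {τ τ' : Config L}
    (h1 : particleCount τ = particleCount τ') (h2 : blocks τ = blocks τ') :
    gibbs p γ N τ = gibbs p γ N τ' := by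
  rw [gibbs, gibbs, h1, h2]

/-! ### The approximate Markov property -/

/-- The pattern `s` stands at the sites following `x`. -/
def Occurs {L : ℕ} (s : List Bool) (x : ZMod L) (τ : Config L) : Prop :=
  ∀ j : Fin s.length, τ (x + ((j : ℕ) + 1 : ℕ)) = s.get j

instance {L : ℕ} (s : List Bool) (x : ZMod L) (τ : Config L) : Decidable (Occurs s x τ) := by
  unfold Occurs; infer_instance

theorem clusterProb_eq {L : ℕ} [NeZero L] (P : Config L → ℝ) (x : ZMod L) (s : List Bool) :
    clusterProb P x s = ∑ τ, if Occurs s x τ then P τ else 0 := rfl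

theorem occurs_append_singleton {L : ℕ} (s : List Bool) (a : Bool) (x : ZMod L) (τ : Config L) :
    Occurs (s ++ [a]) x τ ↔ Occurs s x τ ∧ τ (x + (s.length : ZMod L) + 1) = a := by
  unfold Occurs
  constructor
  · intro h
    refine ⟨fun j => ?_, ?_⟩
    · have := h ⟨j, by simp only [List.length_append]; omega⟩
      simpa using this
    · have := h ⟨s.length, by simp⟩
      simpa [add_assoc] using this
  · rintro ⟨h1, h2⟩ ⟨j, hj⟩
    simp only [List.length_append, List.length_singleton] at hj
    rcases (Nat.lt_succ_iff.1 hj).lt_or_eq with hlt | rfl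
    · have := h1 ⟨j, hlt⟩
      simpa [List.getElem_append_left hlt] using this
    · simpa [add_assoc] using h2

theorem clusterProb_append_add {L : ℕ} [NeZero L] (P : Config L → ℝ) (x : ZMod L) (s : List Bool)
    (a : Bool) :
    clusterProb P x (s ++ [a]) + clusterProb P x (s ++ [!a]) = clusterProb P x s := by
  simp only [clusterProb_eq, occurs_append_singleton]
  rw [← Finset.sum_add_distrib]
  refine Finset.sum_congr rfl fun τ _ => ?_
  by_cases h : Occurs s x τ <;> cases a <;> cases τ (x + (s.length : ZMod L) + 1) <;> simp [h]

/-- Reversing the segment between a pattern that ends in `a` and a later site in the state `a`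
exchanges the bond that follows the pattern with the one that precedes the site. -/
theorem gibbs_exchange {L : ℕ} [NeZero L] (p γ : ℝ) (N : ℕ) (s : List Bool) (a : Bool)
    (x o : ZMod L) (ho : o = x + ((s.length + 1 : ℕ) : ZMod L)) {y : ℕ} (hy : 1 ≤ y)
    (hyL : y + s.length + 1 ≤ L) :
    (∑ τ : Config L, if Occurs (s ++ [a]) x τ ∧ τ (o + 1) = a ∧ τ (o + y + 1) = a
      then gibbs p γ N τ else 0) =
    ∑ τ : Config L, if Occurs (s ++ [a]) x τ ∧ τ (o + y) = a ∧ τ (o + y + 1) = a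
      then gibbs p γ N τ else 0 := by
  have hyL' : y < L := by omega
  rw [← (segRev_involutive o hyL').bijective.sum_comp fun τ : Config L =>
    if Occurs (s ++ [a]) x τ ∧ τ (o + y) = a ∧ τ (o + y + 1) = a then gibbs p γ N τ else 0]
  refine Finset.sum_congr rfl fun τ _ => ?_
  have hlast : segRev o y τ (o + y + 1) = τ (o + y + 1) := by
    have := segRev_of_lt o τ hy (Nat.lt_succ_self y) hyL'
    push_cast at this
    rwa [← add_assoc] at this
  have hyth : segRev o y τ (o + y) = τ (o + 1) := by
    have := segRev_of_le o τ hyL' hy le_rfl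
    simpa using this
  -- the sites of the pattern lie outside the segment
  have hocc : Occurs (s ++ [a]) x (segRev o y τ) ↔ Occurs (s ++ [a]) x τ := by
    refine forall_congr' fun j => ?_
    have hj : (j : ℕ) < s.length + 1 := by simpa using j.2
    have e : x + (((j : ℕ) + 1 : ℕ) : ZMod L) =
        o + ((L - (s.length - j : ℕ) : ℕ) : ZMod L) := by
      rw [ho, Nat.cast_sub (by omega), Nat.cast_sub (by omega)]
      push_cast
      simp only [ZMod.natCast_self]
      ring
    rw [e, segRev_of_lt o τ hy (by omega) (by omega)]
  simp only [hocc, hyth, hlast]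
  by_cases h : Occurs (s ++ [a]) x τ ∧ τ (o + 1) = a ∧ τ (o + y + 1) = a
  · rw [if_pos h, if_pos h]
    have hoa : τ o = a := by
      have := ((occurs_append_singleton s a x τ).1 h.1).2
      rwa [add_assoc, ← Nat.cast_succ, Nat.succ_eq_add_one, ← ho] at this
    exact gibbs_congr p γ N (particleCount_segRev o hyL' τ).symm
      (blocks_segRev_of_eq o hy hyL' (hoa.trans h.2.2.symm)).symm
  · rw [if_neg h, if_neg h]

theorem clusterProb_nonneg {L : ℕ} [NeZero L] {P : Config L → ℝ} (hP : ∀ τ, 0 ≤ P τ) (x : ZMod L)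
    (s : List Bool) : 0 ≤ clusterProb P x s :=
  Finset.sum_nonneg fun τ _ => by split_ifs; exacts [hP τ, le_rfl]

/-- The approximate Markov property of the Gibbs measure: given a pattern that ends in `a`, the
next site is again in the state `a` with the overall frequency of the bonds `aa` among the bonds
that start in `a`. -/
theorem abs_siteCount_mul_sub_le {L : ℕ} [NeZero L] {p γ : ℝ} (hp1 : p < 1) (hpγ : p * γ < 1)
    {N : ℕ} (hN : N ≤ L) (s : List Bool) (a : Bool) (x : ZMod L) :
    |siteCount L N a * clusterProb (gibbs p γ N) x (s ++ [a] ++ [a]) -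
      ∑ τ : Config L, if Occurs (s ++ [a]) x τ then
        gibbs p γ N τ * (siteCount L N a - blocks τ) else 0| ≤ s.length + 1 := by
  have hst := gibbs_isStationaryMeasure (L := L) hp1 hpγ hN
  obtain ⟨o, ho⟩ : ∃ o, o = x + ((s.length + 1 : ℕ) : ZMod L) := ⟨_, rfl⟩
  set F : ℕ → ℝ := fun y =>
    (∑ τ : Config L, if Occurs (s ++ [a]) x τ ∧ τ (o + 1) = a ∧ τ (o + y + 1) = a
      then gibbs p γ N τ else 0) -
    ∑ τ : Config L, if Occurs (s ++ [a]) x τ ∧ τ (o + y) = a ∧ τ (o + y + 1) = a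
      then gibbs p γ N τ else 0 with hF
  have hbd : ∀ q : Config L → Prop, ∀ [DecidablePred q],
      0 ≤ (∑ τ : Config L, if q τ then gibbs p γ N τ else 0) ∧
      (∑ τ : Config L, if q τ then gibbs p γ N τ else 0) ≤ 1 := by
    intro q _
    refine ⟨Finset.sum_nonneg fun τ _ => ?_, ?_⟩
    · split_ifs; exacts [hst.nonneg τ, le_rfl]
    · rw [← hst.total]
      refine Finset.sum_le_sum fun τ _ => ?_
      split_ifs; exacts [le_rfl, hst.nonneg τ]
  have hF1 : ∀ y, |F y| ≤ 1 := by
    intro y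
    have h1 := hbd fun τ => Occurs (s ++ [a]) x τ ∧ τ (o + 1) = a ∧ τ (o + y + 1) = a
    have h2 := hbd fun τ => Occurs (s ++ [a]) x τ ∧ τ (o + y) = a ∧ τ (o + y + 1) = a
    rw [abs_le]
    constructor <;> simp only [hF] <;> linarith [h1.1, h1.2, h2.1, h2.2]
  have hF0 : ∀ y ∈ Finset.Icc 1 (L - (s.length + 1)), F y = 0 := by
    intro y hy
    rw [Finset.mem_Icc] at hy
    exact sub_eq_zero.2 (gibbs_exchange p γ N s a x o ho hy.1 (by omega))
  have hsum : |∑ y ∈ Finset.range L, F y| ≤ s.length + 1 := by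
    have hsub : Finset.Icc 1 (L - (s.length + 1)) ⊆ Finset.range L := by
      intro y hy
      rw [Finset.mem_Icc] at hy
      exact Finset.mem_range.2 (by omega)
    rw [← Finset.sum_sdiff hsub, Finset.sum_eq_zero hF0, add_zero]
    refine (Finset.abs_sum_le_sum_abs _ _).trans ((Finset.sum_le_sum fun y _ => hF1 y).trans ?_)
    rw [Finset.sum_const, Finset.card_sdiff_of_subset hsub, Finset.card_range, Nat.card_Icc,
      nsmul_eq_mul, mul_one]
    exact_mod_cast (by omega)
  refine le_of_eq_of_le ?_ hsum
  congr 1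
  simp only [hF]
  rw [Finset.sum_sub_distrib, Finset.sum_comm, Finset.sum_comm (s := Finset.range L)]
  have hlen : x + ((s ++ [a]).length : ZMod L) = o := by
    rw [ho]; simp
  congr 1
  · rw [clusterProb_eq, Finset.mul_sum]
    refine Finset.sum_congr rfl fun τ _ => ?_
    simp only [occurs_append_singleton (s ++ [a]) a x τ, hlen]
    by_cases h : Occurs (s ++ [a]) x τ ∧ τ (o + 1) = a
    · rw [if_pos h]
      by_cases hτ : particleCount τ = N
      · rw [← hτ, ← sum_site_eq, ← sum_range_eq_sum (o + 1), Finset.sum_mul]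
        refine Finset.sum_congr rfl fun y _ => ?_
        simp [h.1, h.2, add_right_comm]
      · simp [hst.support τ hτ]
    · rw [if_neg h, mul_zero]
      refine (Finset.sum_eq_zero fun y _ => ?_).symm
      exact if_neg fun h' => h ⟨h'.1, h'.2.1⟩
  · refine Finset.sum_congr rfl fun τ _ => ?_
    by_cases h : Occurs (s ++ [a]) x τ
    · rw [if_pos h]
      by_cases hτ : particleCount τ = N
      · rw [← hτ, ← sum_bond_eq, ← sum_range_eq_sum o, Finset.mul_sum]
        refine Finset.sum_congr rfl fun y _ => ?_
        simp [h]
      · simp [hst.support τ hτ]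
    · simp [h]

/-! ### The law of the number of blocks -/

/-- Reversing the segment between a bond `11` and a bond `00` turns both into bonds `10`, at the
cost of one more block. -/
theorem gibbs_bond_exchange {L : ℕ} [NeZero L] (p γ : ℝ) (N : ℕ) (ψ : ℕ → ℝ) {x x' : ZMod L}
    (hx : x ≠ x') :
    (∑ τ : Config L, if (τ x = true ∧ τ (x + 1) = true) ∧ (τ x' = false ∧ τ (x' + 1) = false)
      then gibbs p γ N τ * (ψ (blocks τ + 1) * blockWeight p γ) else 0) =
    ∑ τ : Config L, if (τ x = true ∧ τ (x + 1) = false) ∧ (τ x' = true ∧ τ (x' + 1) = false)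
      then gibbs p γ N τ * ψ (blocks τ) else 0 := by
  obtain ⟨y, hyL, rfl⟩ := exists_eq_add_natCast x x'
  have hy : 1 ≤ y := by
    by_contra h
    have : y = 0 := by omega
    subst this
    simp at hx
  rw [← (segRev_involutive x hyL).bijective.sum_comp fun τ : Config L =>
    if (τ x = true ∧ τ (x + 1) = false) ∧ (τ (x + y) = true ∧ τ (x + y + 1) = false)
      then gibbs p γ N τ * ψ (blocks τ) else 0]
  refine Finset.sum_congr rfl fun τ _ => ?_
  have hlast : segRev x y τ (x + y + 1) = τ (x + y + 1) := by
    have := segRev_of_lt x τ hy (Nat.lt_succ_self y) hyL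
    push_cast at this
    rwa [← add_assoc] at this
  have hfirst : segRev x y τ (x + 1) = τ (x + y) := by
    have := segRev_of_le x τ hyL le_rfl hy
    simpa using this
  have hyth : segRev x y τ (x + y) = τ (x + 1) := by
    have := segRev_of_le x τ hyL hy le_rfl
    simpa using this
  rw [hlast, hfirst, hyth, segRev_self x τ hy hyL]
  by_cases h : (τ x = true ∧ τ (x + 1) = true) ∧ (τ (x + y) = false ∧ τ (x + y + 1) = false)
  · rw [if_pos h, if_pos ⟨⟨h.1.1, h.2.1⟩, h.1.2, h.2.2⟩]
    have hb := blocks_segRev_of_ne x hy hyL h.1.1 h.1.2 h.2.1 h.2.2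
    rw [gibbs, gibbs, particleCount_segRev x hyL, hb]
    split_ifs
    · rw [pow_succ]; ring
    · simp
  · rw [if_neg h, if_neg fun h' => h ⟨⟨h'.1.1, h'.2.1⟩, h'.1.2, h'.2.2⟩]

/-- The recursion for the law of the number of blocks, tested against `ψ`: the exchange of a bond
`11` and a bond `00` for two bonds `10`, summed over the positions of the two bonds. -/
theorem gibbs_blocks_recursion {L : ℕ} [NeZero L] (p γ : ℝ) (N : ℕ) (ψ : ℕ → ℝ) :
    ∑ τ : Config L, gibbs p γ N τ * (ψ (blocks τ + 1) * blockWeight p γ) *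
      ((N - blocks τ) * (L - N - blocks τ)) =
    ∑ τ : Config L, gibbs p γ N τ * ψ (blocks τ) * ((blocks τ : ℝ) ^ 2 - blocks τ) := by
  -- subtracting the diagonal makes the exchange identity valid for `x = x'` too
  have key : ∀ x x' : ZMod L,
      (∑ τ : Config L, if (τ x = true ∧ τ (x + 1) = true) ∧ (τ x' = false ∧ τ (x' + 1) = false)
        then gibbs p γ N τ * (ψ (blocks τ + 1) * blockWeight p γ) else 0) =
      ∑ τ : Config L, gibbs p γ N τ * ψ (blocks τ) *
        ((if τ x = true ∧ τ (x + 1) = false then 1 else 0) *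
          (if τ x' = true ∧ τ (x' + 1) = false then 1 else 0) -
          if x = x' then (if τ x = true ∧ τ (x + 1) = false then 1 else 0) else 0) := by
    intro x x'
    by_cases hx : x = x'
    · subst hx
      refine Finset.sum_congr rfl fun τ _ => ?_
      cases τ x <;> cases τ (x + 1) <;> simp
    · rw [gibbs_bond_exchange p γ N ψ hx]
      refine Finset.sum_congr rfl fun τ _ => ?_
      rw [if_neg hx, sub_zero, ite_and]
      split_ifs <;> simp
  have hsum := Finset.sum_congr rfl fun x (_ : x ∈ (Finset.univ : Finset (ZMod L))) =>
    Finset.sum_congr rfl fun x' (_ : x' ∈ (Finset.univ : Finset (ZMod L))) => key x x'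
  have hswap : ∀ f : ZMod L → ZMod L → Config L → ℝ,
      ∑ x, ∑ x', ∑ τ, f x x' τ = ∑ τ, ∑ x, ∑ x', f x x' τ := by
    intro f
    exact (Finset.sum_congr rfl fun x _ => Finset.sum_comm).trans Finset.sum_comm
  rw [hswap, hswap] at hsum
  convert hsum using 2 with τ _ τ _
  · by_cases hτ : particleCount τ = N
    · have h1 := sum_bond_eq τ true
      have h2 := sum_bond_eq τ false
      simp only [siteCount, if_true, Bool.false_eq_true, if_false, hτ] at h1 h2
      rw [← h1, ← h2, Finset.sum_mul_sum, Finset.mul_sum]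
      refine Finset.sum_congr rfl fun x _ => ?_
      rw [Finset.mul_sum]
      refine Finset.sum_congr rfl fun x' _ => ?_
      by_cases hx : τ x = true ∧ τ (x + 1) = true <;>
        by_cases hx' : τ x' = false ∧ τ (x' + 1) = false <;> simp only [hx, hx'] <;> simp
    · simp [gibbs, hτ]
  · simp_rw [← Finset.mul_sum, Finset.sum_sub_distrib, Finset.sum_ite_eq, Finset.mem_univ, if_true]
    rw [← Finset.sum_mul_sum, ← natCast_blocks, sq]

/-! ### Single-site probabilities -/

theorem clusterProb_singleton {L : ℕ} [NeZero L] {p γ : ℝ} (hp1 : p < 1) (hpγ : p * γ < 1)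
    {N : ℕ} (hN : N ≤ L) (a : Bool) (x : ZMod L) :
    (L : ℝ) * clusterProb (gibbs p γ N) x [a] = siteCount L N a := by
  have hst := gibbs_isStationaryMeasure (L := L) hp1 hpγ hN
  have hone : ∀ x : ZMod L, clusterProb (gibbs p γ N) x [a] =
      ∑ τ : Config L, if τ (x + 1) = a then gibbs p γ N τ else 0 := by
    intro x
    rw [clusterProb_eq]
    refine Finset.sum_congr rfl fun τ _ => ?_
    have := occurs_append_singleton [] a x τ
    simp only [List.nil_append, List.length_nil, Nat.cast_zero, add_zero] at this
    simp only [this]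
    have h0 : Occurs [] x τ := fun j => j.elim0
    simp [h0]
  -- translation invariance
  have hshift : ∀ x' : ZMod L, clusterProb (gibbs p γ N) x' [a] =
      clusterProb (gibbs p γ N) x [a] := by
    intro x'
    rw [hone, hone]
    have hb : Function.Bijective (fun (τ : Config L) (w : ZMod L) => τ (w + (x' - x))) :=
      ((Equiv.addRight (x' - x)).arrowCongr (Equiv.refl Bool)).symm.bijective
    rw [← hb.sum_comp fun τ : Config L => if τ (x + 1) = a then gibbs p γ N τ else 0]
    refine Finset.sum_congr rfl fun τ _ => ?_
    have he : x + 1 + (x' - x) = x' + 1 := by ring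
    have hc : particleCount (fun w => τ (w + (x' - x))) = particleCount τ := by
      zify
      rw [natCast_particleCount, natCast_particleCount]
      exact sum_shift (x' - x) fun w => if τ w = true then (1 : ℤ) else 0
    have hbl : blocks (fun w => τ (w + (x' - x))) = blocks τ := by
      have h := sum_shift (x' - x) fun w => if τ w = true ∧ τ (w + 1) = false then (1 : ℝ) else 0
      rw [← natCast_blocks] at h
      rw [← Nat.cast_inj (R := ℝ), ← h, natCast_blocks]
      refine Finset.sum_congr rfl fun w _ => ?_
      simp [add_right_comm]
    simp only [gibbs_congr p γ N hc hbl, he]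
  have hsum : ∑ x' : ZMod L, clusterProb (gibbs p γ N) x' [a] = siteCount L N a := by
    simp_rw [hone]
    rw [Finset.sum_comm]
    have : ∀ τ : Config L, (∑ x' : ZMod L, if τ (x' + 1) = a then gibbs p γ N τ else 0) =
        gibbs p γ N τ * siteCount L N a := by
      intro τ
      by_cases hτ : particleCount τ = N
      · rw [← hτ, ← sum_site_eq, Finset.mul_sum]
        rw [sum_shift 1 fun w => if τ w = a then gibbs p γ (particleCount τ) τ else 0]
        simp
      · simp [hst.support τ hτ]
    simp_rw [this]
    rw [← Finset.sum_mul, hst.total, one_mul]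
  rw [← hsum, Finset.sum_congr rfl fun x' _ => hshift x']
  simp [ZMod.card]

/-! ### The parameter `z` -/

theorem one_sub_A {p γ : ℝ} (hpγ : p * γ < 1) : 1 - A p γ = (1 - p) / (1 - p * γ) := by
  have : 1 - p * γ ≠ 0 := by linarith
  unfold A
  field_simp
  ring

theorem A_lt_one {p γ : ℝ} (hp1 : p < 1) (hpγ : p * γ < 1) : A p γ < 1 := by
  have h : 0 < 1 - A p γ := by
    rw [one_sub_A hpγ]
    exact div_pos (by linarith) (by linarith)
  linarith

theorem four_mul_A_le_one {p γ ρ : ℝ} (hp1 : p < 1) (hpγ : p * γ < 1) (hρ0 : 0 < ρ)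
    (hρ1 : ρ < 1) : 4 * ρ * (1 - ρ) * A p γ ≤ 1 := by
  have hA := A_lt_one hp1 hpγ
  have h1 : 0 < ρ * (1 - ρ) := mul_pos hρ0 (by linarith)
  nlinarith [sq_nonneg (2 * ρ - 1)]

theorem A_ne_zero {p γ : ℝ} (hp0 : 0 < p) (hpγ : p * γ < 1) (hγ : γ ≠ 1) : A p γ ≠ 0 :=
  div_ne_zero (mul_ne_zero hp0.ne' (sub_ne_zero.2 hγ.symm)) (by linarith)

theorem z_quadratic {p γ ρ : ℝ} (hp0 : 0 < p) (hp1 : p < 1) (hpγ : p * γ < 1) (hρ0 : 0 < ρ)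
    (hρ1 : ρ < 1) : A p γ * z p γ ρ ^ 2 - z p γ ρ + ρ * (1 - ρ) = 0 := by
  by_cases hγ : γ = 1
  · simp [A, z, hγ]
  · have hA := A_ne_zero hp0 hpγ hγ
    have hr := Real.sq_sqrt (sub_nonneg.2 (four_mul_A_le_one hp1 hpγ hρ0 hρ1))
    rw [z, if_neg hγ]
    generalize Real.sqrt (1 - 4 * ρ * (1 - ρ) * A p γ) = r at hr ⊢
    field_simp
    linear_combination hr

/-- The form of `z` in which the case `γ = 1` is not exceptional. -/
theorem z_eq_div {p γ ρ : ℝ} (hp0 : 0 < p) (hp1 : p < 1) (hpγ : p * γ < 1) (hρ0 : 0 < ρ)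
    (hρ1 : ρ < 1) :
    z p γ ρ = 2 * (ρ * (1 - ρ)) / (1 + Real.sqrt (1 - 4 * ρ * (1 - ρ) * A p γ)) := by
  by_cases hγ : γ = 1
  · subst hγ
    simp [A, z]
    ring
  · have hA := A_ne_zero hp0 hpγ hγ
    have hr := Real.sq_sqrt (sub_nonneg.2 (four_mul_A_le_one hp1 hpγ hρ0 hρ1))
    have hr0 := Real.sqrt_nonneg (1 - 4 * ρ * (1 - ρ) * A p γ)
    rw [z, if_neg hγ, div_eq_div_iff (by simpa using hA) (by linarith)]
    linear_combination -hr

theorem z_pos {p γ ρ : ℝ} (hp0 : 0 < p) (hp1 : p < 1) (hpγ : p * γ < 1) (hρ0 : 0 < ρ)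
    (hρ1 : ρ < 1) : 0 < z p γ ρ := by
  rw [z_eq_div hp0 hp1 hpγ hρ0 hρ1]
  have h1 : 0 < ρ * (1 - ρ) := mul_pos hρ0 (by linarith)
  positivity

theorem z_le_half {p γ ρ : ℝ} (hp0 : 0 < p) (hp1 : p < 1) (hpγ : p * γ < 1) (hρ0 : 0 < ρ)
    (hρ1 : ρ < 1) : z p γ ρ ≤ 1 / 2 := by
  rw [z_eq_div hp0 hp1 hpγ hρ0 hρ1]
  have h1 : 0 < ρ * (1 - ρ) := mul_pos hρ0 (by linarith)
  have h2 := Real.sqrt_nonneg (1 - 4 * ρ * (1 - ρ) * A p γ)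
  rw [div_le_div_iff₀ (by linarith) (by norm_num)]
  nlinarith [sq_nonneg (2 * ρ - 1)]

/-- In the limit, opening a block and a gap inside existing ones balances merging two of each. -/
theorem blockWeight_mul_eq {p γ ρ : ℝ} (hp0 : 0 < p) (hp1 : p < 1) (hpγ : p * γ < 1)
    (hρ0 : 0 < ρ) (hρ1 : ρ < 1) :
    blockWeight p γ * (ρ * (1 - ρ) - z p γ ρ + z p γ ρ ^ 2) = z p γ ρ ^ 2 := by
  have h1 := z_quadratic hp0 hp1 hpγ hρ0 hρ1
  have h2 : ρ * (1 - ρ) - z p γ ρ + z p γ ρ ^ 2 = (1 - A p γ) * z p γ ρ ^ 2 := by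
    linear_combination h1
  have h3 : blockWeight p γ * (1 - A p γ) = 1 := by
    rw [one_sub_A hpγ, blockWeight, div_mul_div_comm, mul_comm, div_self]
    exact mul_ne_zero (by linarith) (by linarith)
  rw [h2, ← mul_assoc, h3, one_mul]

/-- By `c (ρ - z) (1 - ρ - z) = z²` the factors `ρ - z` and `1 - ρ - z` have the same sign, and they are
not both negative because `z ≤ 1 / 2`. -/
theorem z_lt {p γ ρ : ℝ} (hp0 : 0 < p) (hp1 : p < 1) (hpγ : p * γ < 1) (hρ0 : 0 < ρ)
    (hρ1 : ρ < 1) : z p γ ρ < ρ := by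
  have hz := z_pos hp0 hp1 hpγ hρ0 hρ1
  have hz2 := z_le_half hp0 hp1 hpγ hρ0 hρ1
  have hprod : 0 < (ρ - z p γ ρ) * (1 - ρ - z p γ ρ) := by
    have h1 := blockWeight_mul_eq hp0 hp1 hpγ hρ0 hρ1
    refine pos_of_mul_pos_right (a := blockWeight p γ) ?_ (blockWeight_pos hp1 hpγ).le
    rw [show (ρ - z p γ ρ) * (1 - ρ - z p γ ρ) = ρ * (1 - ρ) - z p γ ρ + z p γ ρ ^ 2 by ring, h1]
    positivity
  by_contra hle
  have h2 : (ρ - z p γ ρ) ≤ 0 := by linarith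
  have h3 : 0 ≤ 1 - ρ - z p γ ρ := by linarith
  linarith [mul_nonpos_of_nonpos_of_nonneg h2 h3]

theorem z_one_sub (p γ ρ : ℝ) : z p γ (1 - ρ) = z p γ ρ := by
  unfold z
  rw [show (1 - ρ) * (1 - (1 - ρ)) = ρ * (1 - ρ) by ring,
    show 4 * (1 - ρ) * (1 - (1 - ρ)) = 4 * ρ * (1 - ρ) by ring]

/-! ### Concentration of the number of blocks -/

/-- The pointwise form of the second moment estimate: `b` blocks among `n` particles on `l` sites,
with `c` the weight of a block. The drift `b² - c (n - b) (l - n - b)` vanishes near `b = z l` and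
has a slope of at least `z l` there, which is what makes the recursion for `b` confining. -/
theorem sq_le_drift {c z ρ l n b : ℝ} (hc : 0 < c) (hz0 : 0 < z) (hz1 : z ≤ 1 / 2)
    (hcz : c * (ρ * (1 - ρ) - z + z ^ 2) = z ^ 2) (hρ0 : 0 < ρ) (hρ1 : ρ < 1) (hl : 1 ≤ l)
    (hn0 : ρ * l - 1 ≤ n) (hn1 : n ≤ ρ * l) (hb0 : 0 ≤ b) (hbn : b ≤ n) (hbl : b ≤ l - n) :
    z * l * (b - z * l) ^ 2 ≤ (b - z * l) * (b ^ 2 - b) -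
      (b + 1 - z * l) * c * ((n - b) * (l - n - b)) + (1 + 3 * c) * l ^ 2 := by
  -- `θ` is the rounding error of the particle number, and `K` is its effect on `n (l - n)`
  obtain ⟨θ, rfl⟩ : ∃ θ, n = ρ * l - θ := ⟨ρ * l - n, by ring⟩
  have hθ0 : 0 ≤ θ := by linarith
  have hθ1 : θ ≤ 1 := by linarith
  have hzl : z * l ≤ l / 2 := by nlinarith
  have hzl0 : 0 < z * l := by positivity
  set D := b - z * l with hD
  set K := θ * l * (2 * ρ - 1) - θ ^ 2 with hK
  have hDl : |D| ≤ l := abs_le.2 ⟨by linarith, by linarith⟩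
  have hKl : |K| ≤ 2 * l := by
    have h1 : |θ * l * (2 * ρ - 1)| ≤ l := by
      rw [abs_mul, abs_of_nonneg (by positivity)]
      have : |2 * ρ - 1| ≤ 1 := abs_le.2 ⟨by linarith, by linarith⟩
      calc θ * l * |2 * ρ - 1| ≤ 1 * l * 1 := by gcongr
        _ = l := by ring
    have h2 : |θ ^ 2| ≤ l := by
      rw [abs_of_nonneg (sq_nonneg _)]
      nlinarith
    exact (abs_sub _ _).trans (by linarith)
  have h1 : c * (D * K) ≤ c * (l * (2 * l)) := by
    refine mul_le_mul_of_nonneg_left ?_ hc.le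
    refine (le_abs_self _).trans ?_
    rw [abs_mul]
    gcongr
  have h2 : D * b ≤ l * l := by
    refine (le_abs_self _).trans ?_
    rw [abs_mul, abs_of_nonneg hb0]
    gcongr
    linarith
  have h3 : c * ((ρ * l - θ - b) * (l - (ρ * l - θ) - b)) ≤ c * (l * l) := by
    gcongr <;> linarith
  have h4 : 0 ≤ D ^ 2 * (b + c * (l - b - z * l)) := by
    have : 0 ≤ l - b - z * l := by linarith
    positivity
  have key : D * (b ^ 2 - b) - (b + 1 - z * l) * c * ((ρ * l - θ - b) * (l - (ρ * l - θ) - b)) =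
      z * l * D ^ 2 + D ^ 2 * (b + c * (l - b - z * l)) - c * (D * K) - D * b -
        c * ((ρ * l - θ - b) * (l - (ρ * l - θ) - b)) := by
    rw [hK, hD]
    linear_combination (-(b - z * l) * l ^ 2) * hcz
  rw [key]
  nlinarith

theorem blocks_le {L : ℕ} [NeZero L] (τ : Config L) (a : Bool) :
    (blocks τ : ℝ) ≤ siteCount L (particleCount τ) a := by
  rw [← sub_nonneg, ← sum_bond_eq]
  exact Finset.sum_nonneg fun x _ => by split_ifs <;> norm_num

theorem floor_mul_le {L : ℕ} {ρ : ℝ} (hρ1 : ρ < 1) : ⌊ρ * (L : ℝ)⌋₊ ≤ L := by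
  refine Nat.floor_le_of_le ?_
  have : (0 : ℝ) ≤ L := Nat.cast_nonneg L
  nlinarith

/-- The number of blocks has fluctuations of order `√L` around `z L`. -/
theorem blocks_second_moment_le {L : ℕ} [NeZero L] {p γ ρ : ℝ} (hp0 : 0 < p) (hp1 : p < 1)
    (hpγ : p * γ < 1) (hρ0 : 0 < ρ) (hρ1 : ρ < 1) :
    z p γ ρ * ∑ τ : Config L, gibbs p γ ⌊ρ * (L : ℝ)⌋₊ τ * ((blocks τ : ℝ) - z p γ ρ * L) ^ 2 ≤
      (1 + 3 * blockWeight p γ) * L := by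
  set N := ⌊ρ * (L : ℝ)⌋₊ with hNdef
  have hst := gibbs_isStationaryMeasure (L := L) hp1 hpγ (floor_mul_le (ρ := ρ) hρ1)
  rw [← hNdef] at hst
  have hL : (1 : ℝ) ≤ L := by exact_mod_cast NeZero.one_le
  -- with this test function both sides of the recursion are of order `L ^ 3`, and their leading
  -- parts differ by at least `z L` times the second moment
  have hrec := gibbs_blocks_recursion (L := L) p γ N fun b => (b : ℝ) - z p γ ρ * L
  have hpt : ∀ τ : Config L, gibbs p γ N τ *
      (z p γ ρ * L * ((blocks τ : ℝ) - z p γ ρ * L) ^ 2) ≤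
      gibbs p γ N τ * ((blocks τ : ℝ) - z p γ ρ * L) * ((blocks τ : ℝ) ^ 2 - blocks τ) -
      gibbs p γ N τ * ((((blocks τ + 1 : ℕ) : ℝ) - z p γ ρ * L) * blockWeight p γ) *
        ((N - blocks τ) * (L - N - blocks τ)) +
      gibbs p γ N τ * ((1 + 3 * blockWeight p γ) * L ^ 2) := by
    intro τ
    by_cases hτ : particleCount τ = N
    · have hb1 := blocks_le τ true
      have hb2 := blocks_le τ false
      simp only [siteCount, if_true, Bool.false_eq_true, if_false, hτ] at hb1 hb2
      have h := sq_le_drift (blockWeight_pos hp1 hpγ) (z_pos hp0 hp1 hpγ hρ0 hρ1)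
        (z_le_half hp0 hp1 hpγ hρ0 hρ1) (blockWeight_mul_eq hp0 hp1 hpγ hρ0 hρ1) hρ0 hρ1 hL
        (Nat.sub_one_lt_floor (ρ * (L : ℝ))).le (Nat.floor_le (by positivity))
        (Nat.cast_nonneg (blocks τ)) hb1 hb2
      have := mul_le_mul_of_nonneg_left h (hst.nonneg τ)
      refine this.trans (le_of_eq ?_)
      push_cast
      ring
    · simp [hst.support τ hτ]
  have hsum := Finset.sum_le_sum fun τ (_ : τ ∈ (Finset.univ : Finset (Config L))) => hpt τ
  rw [Finset.sum_add_distrib, Finset.sum_sub_distrib, hrec, sub_self, zero_add, ← Finset.sum_mul,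
    hst.total, one_mul] at hsum
  have hL0 : (0 : ℝ) < L := by linarith
  refine le_of_mul_le_mul_right ?_ hL0
  refine le_trans (le_of_eq ?_) (hsum.trans (le_of_eq (by ring)))
  rw [Finset.mul_sum, Finset.sum_mul]
  exact Finset.sum_congr rfl fun τ _ => by ring

/-- The mean deviation, from the second moment by `2 √L |d| ≤ L + d²`. -/
theorem blocks_first_moment_le {L : ℕ} [NeZero L] {p γ ρ : ℝ} (hp0 : 0 < p) (hp1 : p < 1)
    (hpγ : p * γ < 1) (hρ0 : 0 < ρ) (hρ1 : ρ < 1) :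
    ∑ τ : Config L, gibbs p γ ⌊ρ * (L : ℝ)⌋₊ τ * |(blocks τ : ℝ) - z p γ ρ * L| ≤
      (1 + (1 + 3 * blockWeight p γ) / z p γ ρ) / 2 * Real.sqrt L := by
  have hst := gibbs_isStationaryMeasure (L := L) hp1 hpγ (floor_mul_le (ρ := ρ) hρ1)
  have hz := z_pos hp0 hp1 hpγ hρ0 hρ1
  have h2 := blocks_second_moment_le (L := L) hp0 hp1 hpγ hρ0 hρ1
  rw [mul_comm, ← le_div_iff₀ hz] at h2
  have hL0 : (0 : ℝ) < L := by exact_mod_cast NeZero.pos L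
  have hs : 0 < Real.sqrt L := Real.sqrt_pos.2 hL0
  have hss : Real.sqrt L * Real.sqrt L = L := Real.mul_self_sqrt hL0.le
  have hpt : ∀ τ : Config L, gibbs p γ ⌊ρ * (L : ℝ)⌋₊ τ *
      (2 * Real.sqrt L * |(blocks τ : ℝ) - z p γ ρ * L|) ≤
      gibbs p γ ⌊ρ * (L : ℝ)⌋₊ τ * L +
        gibbs p γ ⌊ρ * (L : ℝ)⌋₊ τ * ((blocks τ : ℝ) - z p γ ρ * L) ^ 2 := by
    intro τ
    rw [← mul_add]
    refine mul_le_mul_of_nonneg_left ?_ (hst.nonneg τ)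
    rw [← sq_abs (_ - _)]
    nlinarith [sq_nonneg (Real.sqrt L - |(blocks τ : ℝ) - z p γ ρ * L|)]
  have hsum := Finset.sum_le_sum fun τ (_ : τ ∈ (Finset.univ : Finset (Config L))) => hpt τ
  rw [Finset.sum_add_distrib, ← Finset.sum_mul, hst.total, one_mul] at hsum
  have h3 : 2 * Real.sqrt L *
      ∑ τ : Config L, gibbs p γ ⌊ρ * (L : ℝ)⌋₊ τ * |(blocks τ : ℝ) - z p γ ρ * L| ≤
      2 * Real.sqrt L * ((1 + (1 + 3 * blockWeight p γ) / z p γ ρ) / 2 * Real.sqrt L) := by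
    calc _ = ∑ τ : Config L, gibbs p γ ⌊ρ * (L : ℝ)⌋₊ τ *
          (2 * Real.sqrt L * |(blocks τ : ℝ) - z p γ ρ * L|) := by
          rw [Finset.mul_sum]
          exact Finset.sum_congr rfl fun τ _ => by ring
      _ ≤ _ := hsum
      _ ≤ L + (1 + 3 * blockWeight p γ) * L / z p γ ρ := by linarith
      _ = (1 + (1 + 3 * blockWeight p γ) / z p γ ρ) * (Real.sqrt L * Real.sqrt L) := by
          rw [hss]; ring
      _ = _ := by ring
  exact le_of_mul_le_mul_left h3 (by positivity)

/-! ### The limiting Markov chain -/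

/-- The density of the sites in the state `a`. -/
noncomputable def density (ρ : ℝ) (a : Bool) : ℝ := if a = true then ρ else 1 - ρ

/-- The transition probabilities of the limiting Markov chain of site states. -/
noncomputable def transition (p γ ρ : ℝ) (a b : Bool) : ℝ :=
  if b = a then 1 - z p γ ρ / density ρ a else z p γ ρ / density ρ a

/-- The probability that the chain started in `a` continues with the given states. -/
noncomputable def chainFrom (p γ ρ : ℝ) : Bool → List Bool → ℝ
  | _, [] => 1
  | a, b :: s => transition p γ ρ a b * chainFrom p γ ρ b s

/-- The limiting cluster probabilities: those of a stationary two-state Markov chain. -/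
noncomputable def chainProb (p γ ρ : ℝ) : List Bool → ℝ
  | [] => 1
  | a :: s => density ρ a * chainFrom p γ ρ a s

theorem chainFrom_append (p γ ρ : ℝ) (e : Bool) (s : List Bool) (a b : Bool) :
    chainFrom p γ ρ e (s ++ [a] ++ [b]) =
      chainFrom p γ ρ e (s ++ [a]) * transition p γ ρ a b := by
  induction s generalizing e with
  | nil => simp [chainFrom]
  | cons d s ih =>
    simp only [List.cons_append, chainFrom] at ih ⊢
    rw [ih, mul_assoc]

theorem chainProb_append (p γ ρ : ℝ) (s : List Bool) (a b : Bool) :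
    chainProb p γ ρ (s ++ [a] ++ [b]) = chainProb p γ ρ (s ++ [a]) * transition p γ ρ a b := by
  cases s with
  | nil => simp [chainProb, chainFrom]
  | cons d s =>
    have := chainFrom_append p γ ρ d s a b
    simp only [List.cons_append, chainProb] at this ⊢
    rw [this, mul_assoc]

theorem density_pos {ρ : ℝ} (hρ0 : 0 < ρ) (hρ1 : ρ < 1) (a : Bool) : 0 < density ρ a := by
  unfold density
  split_ifs <;> linarith

/-! ### Convergence of the cluster probabilities -/

theorem tendsto_siteCount_div {ρ : ℝ} (hρ0 : 0 < ρ) (a : Bool) :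
    Tendsto (fun L : ℕ => siteCount (L + 1) ⌊ρ * ((L + 1 : ℕ) : ℝ)⌋₊ a / ((L + 1 : ℕ) : ℝ)) atTop
      (𝓝 (density ρ a)) := by
  have h : Tendsto (fun L : ℕ => (⌊ρ * ((L + 1 : ℕ) : ℝ)⌋₊ : ℝ) / ((L + 1 : ℕ) : ℝ)) atTop (𝓝 ρ) :=
    (tendsto_nat_floor_mul_div_atTop hρ0.le).comp
      (tendsto_natCast_atTop_atTop.comp (tendsto_add_atTop_nat 1))
  cases a
  · refine (h.const_sub 1).congr fun L => ?_
    have : ((L + 1 : ℕ) : ℝ) ≠ 0 := by positivity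
    simp only [siteCount, Bool.false_eq_true, if_false]
    rw [sub_div, div_self this]
  · exact h

theorem clusterProb_le_one {L : ℕ} [NeZero L] {p γ : ℝ} {N : ℕ} {P : Config L → ℝ}
    (hP : IsStationaryMeasure p γ N P) (x : ZMod L) (s : List Bool) : clusterProb P x s ≤ 1 := by
  rw [← hP.total]
  refine Finset.sum_le_sum fun τ _ => ?_
  split_ifs
  exacts [le_rfl, hP.nonneg τ]

/-- The approximate Markov property with the number of blocks replaced by its typical value. -/
theorem abs_markov_le {L : ℕ} [NeZero L] {p γ ρ : ℝ} (hp0 : 0 < p) (hp1 : p < 1)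
    (hpγ : p * γ < 1) (hρ0 : 0 < ρ) (hρ1 : ρ < 1) (s : List Bool) (a : Bool) (x : ZMod L) :
    |siteCount L ⌊ρ * (L : ℝ)⌋₊ a *
        clusterProb (gibbs p γ ⌊ρ * (L : ℝ)⌋₊) x (s ++ [a] ++ [a]) -
      (siteCount L ⌊ρ * (L : ℝ)⌋₊ a - z p γ ρ * L) *
        clusterProb (gibbs p γ ⌊ρ * (L : ℝ)⌋₊) x (s ++ [a])| ≤
      s.length + 1 + (1 + (1 + 3 * blockWeight p γ) / z p γ ρ) / 2 * Real.sqrt L := by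
  set N := ⌊ρ * (L : ℝ)⌋₊ with hNdef
  have hN : N ≤ L := floor_mul_le hρ1
  have hst := gibbs_isStationaryMeasure (L := L) hp1 hpγ hN
  have h1 := abs_siteCount_mul_sub_le hp1 hpγ hN s a x
  have h2 := blocks_first_moment_le (L := L) hp0 hp1 hpγ hρ0 hρ1
  rw [← hNdef] at h2
  have h3 : |∑ τ : Config L, (if Occurs (s ++ [a]) x τ then
      gibbs p γ N τ * ((blocks τ : ℝ) - z p γ ρ * L) else 0)| ≤
      ∑ τ : Config L, gibbs p γ N τ * |(blocks τ : ℝ) - z p γ ρ * L| := by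
    refine (Finset.abs_sum_le_sum_abs _ _).trans (Finset.sum_le_sum fun τ _ => ?_)
    have h0 := mul_nonneg (hst.nonneg τ) (abs_nonneg ((blocks τ : ℝ) - z p γ ρ * L))
    split_ifs
    · rw [abs_mul, abs_of_nonneg (hst.nonneg τ)]
    · simpa using h0
  have h4 : (siteCount L N a - z p γ ρ * L) * clusterProb (gibbs p γ N) x (s ++ [a]) =
      (∑ τ : Config L, if Occurs (s ++ [a]) x τ then
        gibbs p γ N τ * (siteCount L N a - blocks τ) else 0) +
      ∑ τ : Config L, if Occurs (s ++ [a]) x τ then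
        gibbs p γ N τ * ((blocks τ : ℝ) - z p γ ρ * L) else 0 := by
    rw [clusterProb_eq, Finset.mul_sum, ← Finset.sum_add_distrib]
    refine Finset.sum_congr rfl fun τ _ => ?_
    split_ifs
    · ring
    · simp
  rw [h4, ← sub_sub]
  exact (abs_sub _ _).trans (add_le_add h1 (h3.trans h2))

/-- The cluster probabilities of the Gibbs measures converge to those of the Markov chain. -/
theorem tendsto_clusterProb {p γ ρ : ℝ} (hp0 : 0 < p) (hp1 : p < 1) (hpγ : p * γ < 1)
    (hρ0 : 0 < ρ) (hρ1 : ρ < 1) (s : List Bool) (x : (L : ℕ) → ZMod (L + 1)) :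
    Tendsto (fun L : ℕ => clusterProb (gibbs p γ ⌊ρ * ((L + 1 : ℕ) : ℝ)⌋₊) (x L) s) atTop
      (𝓝 (chainProb p γ ρ s)) := by
  induction s using List.reverseRecOn with
  | nil =>
    refine tendsto_const_nhds.congr fun L => ?_
    have hst := gibbs_isStationaryMeasure (L := L + 1) hp1 hpγ
      (floor_mul_le (L := L + 1) (ρ := ρ) hρ1)
    have h0 : ∀ τ : Config (L + 1), Occurs [] (x L) τ := fun τ j => j.elim0
    rw [clusterProb_eq]
    simp only [h0, if_true]
    exact hst.total.symm
  | append_singleton s b ih =>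
    rcases List.eq_nil_or_concat s with rfl | ⟨s, a, rfl⟩
    · refine Tendsto.congr (fun L => ?_) (f₁ := fun L : ℕ =>
        siteCount (L + 1) ⌊ρ * ((L + 1 : ℕ) : ℝ)⌋₊ b / ((L + 1 : ℕ) : ℝ)) ?_
      · have : ((L + 1 : ℕ) : ℝ) ≠ 0 := by positivity
        rw [← clusterProb_singleton hp1 hpγ (floor_mul_le (L := L + 1) (ρ := ρ) hρ1) b (x L),
          mul_div_cancel_left₀ _ this, List.nil_append]
      · simpa [chainProb, chainFrom] using tendsto_siteCount_div hρ0 b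
    · rw [List.concat_eq_append] at ih ⊢
      -- repeating the last state is the approximate Markov property divided by `L`; the other
      -- continuation is the complement
      have hd := density_pos hρ0 hρ1 a
      have hsame : Tendsto (fun L : ℕ => clusterProb (gibbs p γ ⌊ρ * ((L + 1 : ℕ) : ℝ)⌋₊) (x L)
          (s ++ [a] ++ [a])) atTop
          (𝓝 (chainProb p γ ρ (s ++ [a]) * (1 - z p γ ρ / density ρ a))) := by
        set n : ℕ → ℝ := fun L =>
          siteCount (L + 1) ⌊ρ * ((L + 1 : ℕ) : ℝ)⌋₊ a / ((L + 1 : ℕ) : ℝ) with hn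
        have hnlim : Tendsto n atTop (𝓝 (density ρ a)) := tendsto_siteCount_div hρ0 a
        set C := (1 + (1 + 3 * blockWeight p γ) / z p γ ρ) / 2 with hC
        have hcast : Tendsto (fun L : ℕ => ((L + 1 : ℕ) : ℝ)) atTop atTop :=
          tendsto_natCast_atTop_atTop.comp (tendsto_add_atTop_nat 1)
        have herr : Tendsto (fun L : ℕ => ((s.length : ℝ) + 1) / ((L + 1 : ℕ) : ℝ) +
            C / Real.sqrt ((L + 1 : ℕ) : ℝ)) atTop (𝓝 0) := by
          have h1 := hcast.const_div_atTop ((s.length : ℝ) + 1)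
          have h2 := (Real.tendsto_sqrt_atTop.comp hcast).const_div_atTop C
          simpa using h1.add h2
        have hdiff : Tendsto (fun L : ℕ =>
            n L * clusterProb (gibbs p γ ⌊ρ * ((L + 1 : ℕ) : ℝ)⌋₊) (x L) (s ++ [a] ++ [a]) -
            (n L - z p γ ρ) * clusterProb (gibbs p γ ⌊ρ * ((L + 1 : ℕ) : ℝ)⌋₊) (x L) (s ++ [a]))
            atTop (𝓝 0) := by
          refine squeeze_zero_norm (fun L => ?_) herr
          have hpos : (0 : ℝ) < ((L + 1 : ℕ) : ℝ) := by positivity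
          have hsq : Real.sqrt ((L + 1 : ℕ) : ℝ) * Real.sqrt ((L + 1 : ℕ) : ℝ) =
            ((L + 1 : ℕ) : ℝ) := Real.mul_self_sqrt hpos.le
          have hsq0 : 0 < Real.sqrt ((L + 1 : ℕ) : ℝ) := Real.sqrt_pos.2 hpos
          have h := abs_markov_le (L := L + 1) hp0 hp1 hpγ hρ0 hρ1 s a (x L)
          rw [← hC] at h
          rw [Real.norm_eq_abs]
          have he : C / Real.sqrt ((L + 1 : ℕ) : ℝ) =
              C * Real.sqrt ((L + 1 : ℕ) : ℝ) / ((L + 1 : ℕ) : ℝ) := by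
            rw [div_eq_div_iff hsq0.ne' hpos.ne', mul_assoc, hsq]
          rw [he, ← add_div, le_div_iff₀ hpos, ← abs_of_pos hpos, ← abs_mul, abs_of_pos hpos]
          refine le_of_eq_of_le ?_ h
          congr 1
          simp only [hn]
          field_simp
        have hmul : Tendsto (fun L : ℕ =>
            n L * clusterProb (gibbs p γ ⌊ρ * ((L + 1 : ℕ) : ℝ)⌋₊) (x L) (s ++ [a] ++ [a]))
            atTop (𝓝 (0 + (density ρ a - z p γ ρ) * chainProb p γ ρ (s ++ [a]))) :=
          (hdiff.add ((hnlim.sub_const (z p γ ρ)).mul ih)).congr fun L => by ring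
        have hquot := hmul.div hnlim hd.ne'
        have hval : (0 + (density ρ a - z p γ ρ) * chainProb p γ ρ (s ++ [a])) / density ρ a =
            chainProb p γ ρ (s ++ [a]) * (1 - z p γ ρ / density ρ a) := by
          field_simp
          ring
        rw [hval] at hquot
        refine hquot.congr' ?_
        filter_upwards [hnlim.eventually (lt_mem_nhds hd)] with L hL
        exact mul_div_cancel_left₀ _ (ne_of_gt hL)
      rw [chainProb_append]
      by_cases hb : b = a
      · subst hb
        simpa [transition] using hsame
      · have hb' : b = !a := by cases a <;> cases b <;> simp_all
        have hval : chainProb p γ ρ (s ++ [a]) * transition p γ ρ a b =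
            chainProb p γ ρ (s ++ [a]) -
              chainProb p γ ρ (s ++ [a]) * (1 - z p γ ρ / density ρ a) := by
          rw [transition, if_neg hb]
          ring
        rw [hval]
        refine (ih.sub hsame).congr fun L => ?_
        rw [hb', ← clusterProb_append_add _ _ (s ++ [a]) a]
        ring

theorem chainFrom_replicate (p γ ρ : ℝ) (a b : Bool) (hab : b ≠ a) (n : ℕ) :
    chainFrom p γ ρ a (List.replicate n a ++ [b]) =
      (1 - z p γ ρ / density ρ a) ^ n * (z p γ ρ / density ρ a) := by
  induction n with
  | zero => simp [chainFrom, transition, hab]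
  | succ n ih =>
    rw [List.replicate_succ, List.cons_append, chainFrom, ih, transition, if_pos rfl, pow_succ]
    ring

/-! ### The flow -/

theorem occurs_block_iff {L : ℕ} [NeZero L] (n : ℕ) (x : ZMod L) (τ : Config L) :
    Occurs (List.replicate (n + 1) true ++ [false]) (x - 1) τ ↔
      (∀ j ≤ n, τ (x + (j : ZMod L)) = true) ∧ τ (x + (n : ZMod L) + 1) = false := by
  rw [occurs_append_singleton]
  refine and_congr ?_ ?_
  · unfold Occurs
    constructor
    · intro h j hj
      have := h ⟨j, by rw [List.length_replicate]; omega⟩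
      simpa using this
    · intro h j
      have hj : (j : ℕ) < n + 1 := by simpa using j.2
      have := h j (by omega)
      simpa using this
  · rw [show x - 1 + ((List.replicate (n + 1) true).length : ZMod L) + 1 = x + n + 1 by
      simp]

/-- A given particle of a block hops with the probability that at least as many particles move as
stand from it up to the front of the block. -/
theorem sum_outcomeProb_hops {L : ℕ} [NeZero L] (p γ : ℝ) (τ : Config L) (h : Hole τ) {i : ℕ}
    (h1 : 1 ≤ i) (hi : i ≤ blockLength τ h) :
    ∑ k : Outcome τ, (if Hops τ k (h.1 - (i : ZMod L)) then outcomeProb p γ τ k else 0) =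
      p * (p * γ) ^ (i - 1) := by
  have hfac : ∀ k : Outcome τ,
      (if Hops τ k (h.1 - (i : ZMod L)) then outcomeProb p γ τ k else 0) =
      ∏ h' : Hole τ, if h' = h → i ≤ (k h' : ℕ) then hopProb p γ (k h') (blockLength τ h')
        else 0 := by
    intro k
    by_cases hk : i ≤ (k h : ℕ)
    · rw [if_pos ((hops_iff τ k h hi).2 ⟨h1, hk⟩)]
      refine Finset.prod_congr rfl fun h' _ => (if_pos ?_).symm
      rintro rfl
      exact hk
    · rw [if_neg fun hc => hk ((hops_iff τ k h hi).1 hc).2]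
      refine (Finset.prod_eq_zero (Finset.mem_univ h) ?_).symm
      rw [if_neg fun hc => hk (hc rfl)]
  simp_rw [hfac]
  have := Finset.prod_univ_sum
    (fun h : Hole τ => (Finset.univ : Finset (Fin (blockLength τ h + 1))))
    (fun h' j => if h' = h → i ≤ (j : ℕ) then hopProb p γ j (blockLength τ h') else 0)
  rw [Fintype.piFinset_univ] at this
  rw [← this, Finset.prod_eq_single h]
  · simpa using hopProb_tail p γ h1 hi
  · intro h' _ hne
    simpa [hne] using sum_hopProb p γ (blockLength τ h')
  · intro hc
    exact absurd (Finset.mem_univ h) hc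

theorem sum_hops_eq {L : ℕ} [NeZero L] (p γ : ℝ) (τ : Config L) (x : ZMod L) :
    ∑ k : Outcome τ, (if Hops τ k x then outcomeProb p γ τ k else 0) =
      ∑ n ∈ Finset.range L, if Occurs (List.replicate (n + 1) true ++ [false]) (x - 1) τ then
        p * (p * γ) ^ n else 0 := by
  rcases isEmpty_or_nonempty (Hole τ) with he | hne
  · rw [Finset.sum_eq_zero, Finset.sum_eq_zero]
    · intro n _
      refine if_neg fun h => ?_
      have := ((occurs_block_iff n x τ).1 h).2
      rw [eq_true_of_isEmpty τ] at this
      cases this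
    · intro k _
      refine if_neg fun h => ?_
      obtain ⟨h', -⟩ := h
      exact isEmptyElim h'
  · obtain ⟨h, i, hi, rfl⟩ := exists_block τ x
    rcases Nat.eq_zero_or_pos i with rfl | h1
    · rw [Finset.sum_eq_zero, Finset.sum_eq_zero]
      · intro n _
        refine if_neg fun hc => ?_
        have := ((occurs_block_iff n _ τ).1 hc).1 0 (Nat.zero_le n)
        simp [h.2] at this
      · intro k _
        refine if_neg fun hc => ?_
        have := ((hops_iff τ k h hi).1 hc).1
        omega
    · rw [sum_outcomeProb_hops p γ τ h h1 hi]
      have hiL := blockLength_lt τ h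
      rw [Finset.sum_eq_single (i - 1)]
      · rw [if_pos]
        rw [occurs_block_iff]
        constructor
        · intro j hj
          rw [show h.1 - (i : ZMod L) + j = h.1 - ((i - j : ℕ) : ZMod L) by
            rw [Nat.cast_sub (by omega)]; ring]
          exact occupied_of_le_blockLength τ h (by omega) (by omega)
        · rw [Nat.cast_sub h1]
          simpa using h.2
      · intro n _ hn
        refine if_neg fun hc => ?_
        rw [occurs_block_iff] at hc
        rcases lt_or_gt_of_ne hn with hlt | hgt
        · have := occupied_of_le_blockLength τ h (i := i - (n + 1)) (by omega) (by omega)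
          rw [Nat.cast_sub (by omega), show h.1 - ((i : ZMod L) - ((n + 1 : ℕ) : ZMod L)) =
            h.1 - i + n + 1 by push_cast; ring, hc.2] at this
          cases this
        · have := hc.1 i (by omega)
          simp [h.2] at this
      · intro hc
        exact absurd (Finset.mem_range.2 (by omega)) hc

/-- The particle at `x` can hop only if some `n` further particles stand directly in front of it
and a hole in front of these. -/
theorem flow_eq_sum {L : ℕ} [NeZero L] (p γ : ℝ) (P : Config L → ℝ) (x : ZMod L) :
    flow p γ P x = ∑ n ∈ Finset.range L,
      clusterProb P (x - 1) (List.replicate (n + 1) true ++ [false]) * (p * (p * γ) ^ n) := by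
  unfold flow
  simp_rw [sum_hops_eq, clusterProb_eq, Finset.sum_mul, Finset.mul_sum]
  rw [Finset.sum_comm]
  refine Finset.sum_congr rfl fun n _ => Finset.sum_congr rfl fun τ _ => ?_
  split_ifs <;> simp

theorem hasSum_flow {p γ ρ : ℝ} (hp0 : 0 < p) (hp1 : p < 1) (hγ0 : 0 ≤ γ) (hpγ : p * γ < 1)
    (hρ0 : 0 < ρ) (hρ1 : ρ < 1) :
    HasSum (fun n : ℕ => chainProb p γ ρ (List.replicate (n + 1) true ++ [false]) *
      (p * (p * γ) ^ n)) (flowValue p γ ρ) := by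
  have hz := z_pos hp0 hp1 hpγ hρ0 hρ1
  have hzρ := z_lt hp0 hp1 hpγ hρ0 hρ1
  have hq0 : 0 ≤ 1 - z p γ ρ / ρ := sub_nonneg.2 ((div_le_one hρ0).2 hzρ.le)
  have hq1 : 1 - z p γ ρ / ρ ≤ 1 := by
    have : 0 < z p γ ρ / ρ := div_pos hz hρ0
    linarith
  have hpγ0 : 0 ≤ p * γ := mul_nonneg hp0.le hγ0
  have hgeo := (hasSum_geometric_of_lt_one (mul_nonneg hpγ0 hq0)
    ((mul_le_of_le_one_right hpγ0 hq1).trans_lt hpγ)).mul_left (p * z p γ ρ)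
  rw [← div_eq_mul_inv] at hgeo
  have hterm : (fun n : ℕ => chainProb p γ ρ (List.replicate (n + 1) true ++ [false]) *
      (p * (p * γ) ^ n)) = fun n => p * z p γ ρ * (p * γ * (1 - z p γ ρ / ρ)) ^ n := by
    funext n
    rw [List.replicate_succ, List.cons_append, chainProb,
      chainFrom_replicate p γ ρ true false (by simp), mul_pow (p * γ)]
    simp only [density, if_true]
    linear_combination (p * (p * γ) ^ n * (1 - z p γ ρ / ρ) ^ n) * mul_div_cancel₀ (z p γ ρ) hρ0.ne'
  rw [hterm]
  exact hgeo

/-- Termwise convergence of the series for the flow, dominated by a geometric series. -/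
theorem tendsto_flow {p γ ρ : ℝ} (hp0 : 0 < p) (hp1 : p < 1) (hγ0 : 0 ≤ γ) (hpγ : p * γ < 1)
    (hρ0 : 0 < ρ) (hρ1 : ρ < 1) (x : (L : ℕ) → ZMod (L + 1)) :
    Tendsto (fun L : ℕ => flow p γ (gibbs p γ ⌊ρ * ((L + 1 : ℕ) : ℝ)⌋₊) (x L)) atTop
      (𝓝 (flowValue p γ ρ)) := by
  have hpγ0 : 0 ≤ p * γ := mul_nonneg hp0.le hγ0
  set f : ℕ → ℕ → ℝ := fun L n => if n ∈ Finset.range (L + 1) then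
    clusterProb (gibbs p γ ⌊ρ * ((L + 1 : ℕ) : ℝ)⌋₊) (x L - 1)
      (List.replicate (n + 1) true ++ [false]) * (p * (p * γ) ^ n) else 0 with hf
  have hflow : ∀ L, ∑' n, f L n = flow p γ (gibbs p γ ⌊ρ * ((L + 1 : ℕ) : ℝ)⌋₊) (x L) := by
    intro L
    rw [flow_eq_sum, tsum_eq_sum (s := Finset.range (L + 1)) fun n hn => if_neg hn]
    exact Finset.sum_congr rfl fun n hn => if_pos hn
  have hlim := tendsto_tsum_of_dominated_convergence (𝓕 := atTop) (f := f)
    (g := fun n => chainProb p γ ρ (List.replicate (n + 1) true ++ [false]) * (p * (p * γ) ^ n))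
    (bound := fun n => p * (p * γ) ^ n)
    ((summable_geometric_of_lt_one hpγ0 hpγ).mul_left p) (fun n => ?_)
    (Eventually.of_forall fun L n => ?_)
  · rw [(hasSum_flow hp0 hp1 hγ0 hpγ hρ0 hρ1).tsum_eq] at hlim
    exact hlim.congr hflow
  · refine ((tendsto_clusterProb hp0 hp1 hpγ hρ0 hρ1 (List.replicate (n + 1) true ++ [false])
      fun L => x L - 1).mul_const (p * (p * γ) ^ n)).congr' ?_
    filter_upwards [eventually_ge_atTop n] with L hL
    exact (if_pos (Finset.mem_range.2 (by omega))).symm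
  · have hst := gibbs_isStationaryMeasure (L := L + 1) hp1 hpγ
      (floor_mul_le (L := L + 1) (ρ := ρ) hρ1)
    have h0 := clusterProb_nonneg hst.nonneg (x L - 1) (List.replicate (n + 1) true ++ [false])
    have h1 := clusterProb_le_one hst (x L - 1) (List.replicate (n + 1) true ++ [false])
    have h2 : 0 ≤ p * (p * γ) ^ n := by positivity
    simp only [hf]
    split_ifs
    · rw [Real.norm_eq_abs, abs_of_nonneg (mul_nonneg h0 h2)]
      exact mul_le_of_le_one_left h2 h1
    · simpa using h2

/-! ### The cluster-size and distance-headway laws -/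

/-- Given a site in the state `b` of the limiting chain, the law of the number of sites in the
other state before the next site in the state `b`. -/
theorem chainProb_cluster {p γ ρ : ℝ} (hρ0 : 0 < ρ) (hρ1 : ρ < 1) {a b : Bool} (hab : a ≠ b)
    (n : ℕ) :
    chainProb p γ ρ ([b] ++ List.replicate n a ++ [b]) / chainProb p γ ρ [b] =
      clusterLaw p γ (density ρ a) n := by
  have ha := density_pos hρ0 hρ1 a
  have hb := density_pos hρ0 hρ1 b
  have hsum : density ρ b = 1 - density ρ a := by
    cases a <;> cases b <;> simp_all [density]
  have hz : z p γ (density ρ a) = z p γ ρ := by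
    cases a
    · exact z_one_sub p γ ρ
    · rfl
  rw [clusterLaw, hz, ← hsum]
  simp only [List.cons_append, List.nil_append, chainProb]
  simp only [chainFrom, mul_one]
  rw [mul_div_cancel_left₀ _ hb.ne']
  cases n with
  | zero => simp [chainFrom, transition]
  | succ n =>
    rw [List.replicate_succ, List.cons_append, chainFrom,
      chainFrom_replicate p γ ρ a b hab.symm, transition, if_neg hab, if_neg (Nat.succ_ne_zero n),
      Nat.add_sub_cancel]
    field_simp

end GenTASEP

theorem mainTheorem3 (p γ ρ : ℝ) (hp0 : 0 < p) (hp1 : p < 1) (hγ0 : 0 ≤ γ) (hγ1 : γ < 1 / p)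
    (hρ0 : 0 < ρ) (hρ1 : ρ < 1) :
    -- on each ring and for each number of particles the stationary measure is well defined
    (∀ (L : ℕ) [NeZero L] (N : ℕ), N ≤ L →
      ∃! P : GenTASEP.Config L → ℝ, GenTASEP.IsStationaryMeasure p γ N P) ∧
    -- `z` solves the quadratic equation
    GenTASEP.A p γ * GenTASEP.z p γ ρ ^ 2 - GenTASEP.z p γ ρ + ρ * (1 - ρ) = 0 ∧
    -- `P L` is the stationary measure on the ring with `L + 1` sites
    ∀ P : (L : ℕ) → GenTASEP.Config (L + 1) → ℝ,
      (∀ L : ℕ, GenTASEP.IsStationaryMeasure p γ ⌊ρ * ((L + 1 : ℕ) : ℝ)⌋₊ (P L)) →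
      ∃ Pρ : List Bool → ℝ,
        -- all cluster probabilities, at arbitrary sites, converge to those of `Pρ`
        (∀ (s : List Bool) (x : (L : ℕ) → ZMod (L + 1)),
          Tendsto (fun L => GenTASEP.clusterProb (P L) (x L) s) atTop (𝓝 (Pρ s))) ∧
        Pρ [true] = ρ ∧ Pρ [false] = 1 - ρ ∧
        -- cluster-size law
        (∀ n : ℕ, Pρ ([false] ++ List.replicate n true ++ [false]) / Pρ [false] =
          GenTASEP.clusterLaw p γ ρ n) ∧
        -- distance-headway law
        (∀ d : ℕ, Pρ ([true] ++ List.replicate d false ++ [true]) / Pρ [true] =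
          GenTASEP.clusterLaw p γ (1 - ρ) d) ∧
        -- flow, as the limit of the stationary flow and as a series
        (∀ x : (L : ℕ) → ZMod (L + 1),
          Tendsto (fun L => GenTASEP.flow p γ (P L) (x L)) atTop
            (𝓝 (GenTASEP.flowValue p γ ρ))) ∧
        HasSum (fun n : ℕ => Pρ (List.replicate (n + 1) true ++ [false]) * (p * (p * γ) ^ n))
          (GenTASEP.flowValue p γ ρ) := by

  have hpγ : p * γ < 1 := by
    rw [mul_comm]
    exact (lt_div_iff₀ hp0).1 hγ1
  refine ⟨fun L _ N hN => ⟨GenTASEP.gibbs p γ N,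
    GenTASEP.gibbs_isStationaryMeasure hp1 hpγ hN, fun P hP => hP.eq_gibbs hp0 hp1 hγ0 hpγ⟩,
    GenTASEP.z_quadratic hp0 hp1 hpγ hρ0 hρ1, fun P hP => ?_⟩
  have hPg : P = fun L => GenTASEP.gibbs p γ ⌊ρ * ((L + 1 : ℕ) : ℝ)⌋₊ :=
    funext fun L => (hP L).eq_gibbs hp0 hp1 hγ0 hpγ
  subst hPg
  refine ⟨GenTASEP.chainProb p γ ρ, GenTASEP.tendsto_clusterProb hp0 hp1 hpγ hρ0 hρ1,
    by simp [GenTASEP.chainProb, GenTASEP.chainFrom, GenTASEP.density],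
    by simp [GenTASEP.chainProb, GenTASEP.chainFrom, GenTASEP.density],
    GenTASEP.chainProb_cluster hρ0 hρ1 (a := true) (b := false) (by simp),
    GenTASEP.chainProb_cluster hρ0 hρ1 (a := false) (b := true) (by simp),
    GenTASEP.tendsto_flow hp0 hp1 hγ0 hpγ hρ0 hρ1, GenTASEP.hasSum_flow hp0 hp1 hγ0 hpγ hρ0 hρ1⟩
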